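/- Write $\log_2 t=\log\log t$, $e(x)=e^{2\pi i x}$, and for real functions $g,h$ defined for large $t$ write $g\prec h$ if $h(t)/g(t)\to+\infty$ as $t\to\infty$. A Hardy field is a subfield of the ring of germs at $+\infty$ of real-valued functions on $[1,\infty)$ that is closed under differentiation. Exponents on $\log$ and $\log_2$ denote powers, so $\log_2^4(t)=(\log\log t)^4$. Let $\mathcal H$ be a Hardy field, let $k\ge 1$, and let $f_1,\dots,f_k:[1,\infty)\to\mathbb R$ have germs in $\mathcal H$. Put $f(t)=(f_1(t),\dots,f_k(t))$ and $E(t)=\min\{|f_1(t)|,\dots,|f_k(t)|\}$. Suppose that (i) for every $i$ there is an integer $j\ge 1$ with $t^{j-1}\prec f_i(t)\prec t^{j}$; (ii) $\log_2(t)\prec\log(f_i(t))$ for every $i$; (iii) after reordering $f_1,\dots,f_k$ if necessary, $\log_2^4(t)\prec \dfrac{f_{i+1}(t)}{f_i(t)}$ for $i=1,\dots,k-1$. Then there is a constant $C>0$ such that for all positive integers $M$, all real numbers $$r,s\in\left[1,\ \min\left\{M\log^2(M),\ \frac{E(M)}{\log^4(M)}\right\}\right]\quad\text{with } r\ge s,$$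 and all $\tau\in\left[-\log_2^2(M),\log_2^2(M)\right]^k\cap\mathbb Z^k$ with $\tau\ne(0,\dots,0)$, $$\left|\sum_{n=M}^{2M} e\left(\frac1r\langle f(sn),\tau\rangle\right)\right|\le \frac{C\,M}{\log^2(M)}.$$ (For $M=1$ and $M=2$ the interval for $r,s$ is empty, because $M\log^2(M)<1$, so nothing is claimed.) -/

import Mathlib

open Filter

/-- A Hardy field: a subring of the ring of germs at `+∞` of real functions which is a field and
is closed under differentiation, that is, every function representing an element is differentiable
at all large `t` and its derivative represents an element again. -/
structure IsHardyField (H : Subring (Germ (atTop : Filter ℝ) ℝ)) : Prop where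
  isField : IsField H
  differentiable : ∀ g : ℝ → ℝ, (g : Germ (atTop : Filter ℝ) ℝ) ∈ H →
    ∀ᶠ t in atTop, DifferentiableAt ℝ g t
  deriv_mem : ∀ g : ℝ → ℝ, (g : Germ (atTop : Filter ℝ) ℝ) ∈ H →
    ((deriv g : ℝ → ℝ) : Germ (atTop : Filter ℝ) ℝ) ∈ H

/-- `f ≺ g`: the quotient `g(t) / f(t)` tends to `+∞` as `t → ∞`. -/
def GrowthLT (f g : ℝ → ℝ) : Prop :=
  Tendsto (fun t => g t / f t) atTop atTop

/-- There is a positive integer `j` with `t ^ (j - 1) ≺ f(t) ≺ t ^ j`. -/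
def StrictlyBetweenPowers (f : ℝ → ℝ) : Prop :=
  ∃ j : ℕ, 1 ≤ j ∧ GrowthLT (fun t => t ^ (j - 1)) f ∧ GrowthLT f (fun t => t ^ j)

/-- `E(t) = min {|f₁(t)|, …, |f_k(t)|}` (an infimum over a finite, nonempty family). -/
noncomputable def minAbs {k : ℕ} (f : Fin k → ℝ → ℝ) (t : ℝ) : ℝ :=
  ⨅ i, |f i t|

/-- `e(x) = exp(2πix)`. -/
noncomputable def expTwoPiI (x : ℝ) : ℂ :=
  Complex.exp (2 * Real.pi * Complex.I * x)

/-! Let i be the fastest growing index with τ_i ≠ 0, and put G = f_i(sM)/r. For large M the i-th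
term governs every fixed derivative of the phase φ(x) = ⟨f(sx),τ⟩/r on [M, 4M]. Indeed
differentiation costs a ratio f_i/f_l only an arbitrarily small power
(`eventually_pow_div_le_pow_deriv_div`), so the ratio of m-th derivatives stays above log_2^3 and
beats coefficients of size log_2^2. The m-th derivative of φ then has size G/M^m up to a factor
M^(1/8) (`eventually_leading_term_bounds`) and constant sign, so the forward differences of the
phase are monotone and of known size.

Since r ≤ E(M)/log^4 M and f_i is eventually nondecreasing, G ≥ log^4 M. If G ≤ M^(1/2), hypothesis
(ii) gives f_i ≤ f_i' t log t, hence |φ'| ≥ log^3 M/(32M), and the Kusmin–Landau inequality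
`norm_sum_expTwoPiI_le_inv` bounds the sum by 32M/log^3 M. If M^(q-1/2) ≤ G ≤ M^(q+1/2) with q ≥ 1,
the derivative of order q+1 lies well inside (M^(-2), 1), and q van der Corput steps followed by
Kusmin–Landau save a power of M (`hasPowerSaving`). Only finitely many q occur, because sM ≤ M^4 and
f_i is polynomially bounded.

Hardy fields enter through dichotomy: if a bound on a derivative fails, the reverse bound holds for
all large t and can be integrated to a contradiction. H need not contain t or log t, so signs of t^n
+ h and t log t + h are found by differentiating until H decides them. -/

/-! ### Eventual signs -/

/-- Eventually positive, eventually zero, or eventually negative. -/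
def EventuallySigned (v : ℝ → ℝ) : Prop :=
  (∀ᶠ t in atTop, 0 < v t) ∨ (∀ᶠ t in atTop, v t = 0) ∨ ∀ᶠ t in atTop, v t < 0

namespace EventuallySigned

theorem congr {v w : ℝ → ℝ} (hv : EventuallySigned v) (h : v =ᶠ[atTop] w) :
    EventuallySigned w := by
  rcases hv with hv | hv | hv
  · exact Or.inl (by filter_upwards [hv, h] with t h1 h2; rwa [← h2])
  · exact Or.inr (Or.inl (by filter_upwards [hv, h] with t h1 h2; rwa [← h2]))
  · exact Or.inr (Or.inr (by filter_upwards [hv, h] with t h1 h2; rwa [← h2]))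

theorem neg {v : ℝ → ℝ} (hv : EventuallySigned v) : EventuallySigned (fun t => -v t) := by
  rcases hv with hv | hv | hv
  · exact Or.inr (Or.inr (hv.mono fun t h => by linarith))
  · exact Or.inr (Or.inl (hv.mono fun t h => by simp [h]))
  · exact Or.inl (hv.mono fun t h => by linarith)

theorem mul {v w : ℝ → ℝ} (hv : EventuallySigned v) (hw : EventuallySigned w) :
    EventuallySigned (fun t => v t * w t) := by
  have key : ∀ {v w : ℝ → ℝ}, (∀ᶠ t in atTop, 0 < v t) → EventuallySigned w →
      EventuallySigned (fun t => v t * w t) := by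
    intro v w hv hw
    rcases hw with hw | hw | hw
    · exact Or.inl (by filter_upwards [hv, hw] with t h1 h2 using mul_pos h1 h2)
    · exact Or.inr (Or.inl (by filter_upwards [hw] with t h2; simp [h2]))
    · exact Or.inr (Or.inr (by filter_upwards [hv, hw] with t h1 h2
                               exact mul_neg_of_pos_of_neg h1 h2))
  rcases hv with hv | hv | hv
  · exact key hv hw
  · exact Or.inr (Or.inl (by filter_upwards [hv] with t h2; simp [h2]))
  · have h := (key (v := fun t => -v t) (hv.mono fun t h => by linarith) hw).neg
    exact h.congr (Eventually.of_forall fun t => by simp)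

/-- A derivative of constant sign makes v eventually strictly monotone or constant, so v settles on
one sign. -/
theorem of_deriv {v : ℝ → ℝ} (hd : ∀ᶠ t in atTop, DifferentiableAt ℝ v t)
    (hv : EventuallySigned (deriv v)) : EventuallySigned v := by
  have key : ∀ {v : ℝ → ℝ}, (∀ᶠ t in atTop, DifferentiableAt ℝ v t) →
      (∀ᶠ t in atTop, 0 < deriv v t) → EventuallySigned v := by
    intro v hd hv
    obtain ⟨a, ha⟩ := eventually_atTop.1 (hd.and hv)
    have hmono : StrictMonoOn v (Set.Ici a) := by
      refine strictMonoOn_of_deriv_pos (convex_Ici a)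
        (fun t ht => (ha t ht).1.continuousAt.continuousWithinAt) fun t ht => ?_
      rw [interior_Ici] at ht
      exact (ha t ht.le).2
    by_cases h : ∃ b, a ≤ b ∧ 0 ≤ v b
    · obtain ⟨b, hab, hb⟩ := h
      refine Or.inl ((eventually_gt_atTop b).mono fun t ht => hb.trans_lt ?_)
      exact hmono hab (hab.trans ht.le) ht
    · push Not at h
      exact Or.inr (Or.inr ((eventually_ge_atTop a).mono fun t ht => h t ht))
  rcases hv with hv | hv | hv
  · exact key hd hv
  · obtain ⟨a, ha⟩ := eventually_atTop.1 (hd.and hv)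
    have hc : ContinuousOn v (Set.Ici a) :=
      fun t ht => (ha t ht).1.continuousAt.continuousWithinAt
    have hdi : DifferentiableOn ℝ v (interior (Set.Ici a)) := by
      intro t ht
      rw [interior_Ici] at ht
      exact (ha t ht.le).1.differentiableWithinAt
    have h1 := monotoneOn_of_deriv_nonneg (convex_Ici a) hc hdi fun t ht => by
      rw [interior_Ici] at ht
      exact (ha t ht.le).2.ge
    have h2 := antitoneOn_of_deriv_nonpos (convex_Ici a) hc hdi fun t ht => by
      rw [interior_Ici] at ht
      exact (ha t ht.le).2.le
    have h3 : ∀ t, a ≤ t → v t = v a := fun t ht =>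
      le_antisymm (h2 (Set.mem_Ici.2 le_rfl) ht ht) (h1 (Set.mem_Ici.2 le_rfl) ht ht)
    rcases lt_trichotomy (v a) 0 with h | h | h
    · exact Or.inr (Or.inr ((eventually_ge_atTop a).mono fun t ht => by rw [h3 t ht]; exact h))
    · exact Or.inr (Or.inl ((eventually_ge_atTop a).mono fun t ht => by rw [h3 t ht]; exact h))
    · exact Or.inl ((eventually_ge_atTop a).mono fun t ht => by rw [h3 t ht]; exact h)
  · have h := key (v := fun t => -v t) (hd.mono fun t h => h.neg) (hv.mono fun t h => by
      have : deriv (fun t => -v t) t = -deriv v t := deriv.fun_neg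
      linarith)
    exact h.neg.congr (Eventually.of_forall fun t => by simp)

theorem of_hasDerivAt {v w : ℝ → ℝ} (hd : ∀ᶠ t in atTop, HasDerivAt v (w t) t)
    (hw : EventuallySigned w) : EventuallySigned v :=
  of_deriv (hd.mono fun _ h => h.differentiableAt) (hw.congr (hd.mono fun _ h => h.deriv.symm))

end EventuallySigned

/-! ### Closure properties and signs in a Hardy field -/

/-- The germ of `g` at `+∞` lies in `H`. -/
def GermMem (H : Subring (Germ (atTop : Filter ℝ) ℝ)) (g : ℝ → ℝ) : Prop :=
  (g : Germ (atTop : Filter ℝ) ℝ) ∈ H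

namespace GermMem

variable {H : Subring (Germ (atTop : Filter ℝ) ℝ)} {g h : ℝ → ℝ}

theorem congr (hg : GermMem H g) (e : g =ᶠ[atTop] h) : GermMem H h := by
  unfold GermMem at *
  rwa [← Germ.coe_eq.2 e]

theorem add (hg : GermMem H g) (hh : GermMem H h) : GermMem H (fun t => g t + h t) :=
  H.add_mem hg hh

theorem sub (hg : GermMem H g) (hh : GermMem H h) : GermMem H (fun t => g t - h t) :=
  H.sub_mem hg hh

theorem neg (hg : GermMem H g) : GermMem H (fun t => -g t) :=
  H.neg_mem hg

theorem mul (hg : GermMem H g) (hh : GermMem H h) : GermMem H (fun t => g t * h t) :=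
  H.mul_mem hg hh

theorem pow (hg : GermMem H g) (n : ℕ) : GermMem H (fun t => g t ^ n) :=
  H.pow_mem hg n

theorem natCast (n : ℕ) : GermMem H (fun _ => (n : ℝ)) :=
  natCast_mem H n

theorem deriv (hH : IsHardyField H) (hg : GermMem H g) : GermMem H (deriv g) :=
  hH.deriv_mem g hg

theorem hasDerivAt (hH : IsHardyField H) (hg : GermMem H g) :
    ∀ᶠ t in atTop, HasDerivAt g (_root_.deriv g t) t :=
  (hH.differentiable g hg).mono fun _ h => h.hasDerivAt

theorem inv (hH : IsHardyField H) (hg : GermMem H g) : GermMem H (fun t => (g t)⁻¹) := by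
  by_cases h0 : (g : Germ (atTop : Filter ℝ) ℝ) = 0
  · have : (g : ℝ → ℝ) =ᶠ[atTop] fun t => (g t)⁻¹ := by
      have h0' : g =ᶠ[atTop] fun _ => (0 : ℝ) := Germ.coe_eq.1 h0
      filter_upwards [h0'] with t ht
      simp [ht]
    exact hg.congr this
  · obtain ⟨⟨b, hbH⟩, hb⟩ := hH.isField.mul_inv_cancel (a := ⟨(g : Germ _ ℝ), hg⟩)
      (fun h => h0 (congrArg Subtype.val h))
    have hb' : (g : Germ (atTop : Filter ℝ) ℝ) * b = 1 := congrArg Subtype.val hb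
    induction b using Germ.inductionOn with
    | h b =>
      have e : (fun t => g t * b t) =ᶠ[atTop] fun _ => (1 : ℝ) := Germ.coe_eq.1 hb'
      refine GermMem.congr (g := b) hbH ?_
      filter_upwards [e] with t ht
      exact eq_inv_of_mul_eq_one_right ht

/-- A nonzero germ is invertible, hence eventually nonvanishing; being eventually continuous, it
cannot change sign. -/
theorem eventuallySigned (hH : IsHardyField H) (hg : GermMem H g) : EventuallySigned g := by
  by_cases h0 : (g : Germ (atTop : Filter ℝ) ℝ) = 0
  · exact Or.inr (Or.inl (Germ.coe_eq.1 h0))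
  · obtain ⟨⟨b, hbH⟩, hb⟩ := hH.isField.mul_inv_cancel (a := ⟨(g : Germ _ ℝ), hg⟩)
      (fun h => h0 (congrArg Subtype.val h))
    have hb' : (g : Germ (atTop : Filter ℝ) ℝ) * b = 1 := congrArg Subtype.val hb
    have hne : ∀ᶠ t in atTop, g t ≠ 0 := by
      induction b using Germ.inductionOn with
      | h b =>
        have e : (fun t => g t * b t) =ᶠ[atTop] fun _ => (1 : ℝ) := Germ.coe_eq.1 hb'
        filter_upwards [e] with t ht h
        simp [h] at ht
    obtain ⟨a, ha⟩ := eventually_atTop.1 (hne.and (hH.differentiable g hg))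
    have hc : ContinuousOn g (Set.Ici a) :=
      fun t ht => (ha t ht).2.continuousAt.continuousWithinAt
    have himg : (g '' Set.Ici a).OrdConnected :=
      ((isPreconnected_Ici).image g hc).ordConnected
    rcases lt_or_gt_of_ne (ha a le_rfl).1 with h | h
    · refine Or.inr (Or.inr ((eventually_ge_atTop a).mono fun t ht => ?_))
      by_contra hcon
      push Not at hcon
      obtain ⟨x, hx, hx0⟩ := himg.out ⟨a, Set.mem_Ici.2 le_rfl, rfl⟩ ⟨t, ht, rfl⟩ ⟨h.le, hcon⟩
      exact (ha x hx).1 hx0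
    · refine Or.inl ((eventually_ge_atTop a).mono fun t ht => ?_)
      by_contra hcon
      push Not at hcon
      obtain ⟨x, hx, hx0⟩ := himg.out ⟨t, ht, rfl⟩ ⟨a, Set.mem_Ici.2 le_rfl, rfl⟩ ⟨hcon, h.le⟩
      exact (ha x hx).1 hx0

theorem abs (hH : IsHardyField H) (hg : GermMem H g) : GermMem H (fun t => |g t|) := by
  rcases hg.eventuallySigned hH with h | h | h
  · exact hg.congr (h.mono fun t ht => (abs_of_pos ht).symm)
  · exact hg.congr (h.mono fun t ht => by simp [ht])
  · exact hg.neg.congr (h.mono fun t ht => (abs_of_neg ht).symm)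

theorem iteratedDeriv (hH : IsHardyField H) (hg : GermMem H g) (m : ℕ) :
    GermMem H (iteratedDeriv m g) := by
  induction m with
  | zero => rwa [iteratedDeriv_zero]
  | succ m ih => rw [iteratedDeriv_succ]; exact ih.deriv hH

/-- `t ^ n + h(t)` is eventually of constant sign when `h` belongs to a Hardy field. -/
theorem eventuallySigned_pow_add (hH : IsHardyField H) (n : ℕ) :
    ∀ {h : ℝ → ℝ}, GermMem H h → EventuallySigned (fun t => t ^ n + h t) := by
  induction n with
  | zero =>
    intro h hh
    exact ((natCast 1).add hh).eventuallySigned hH |>.congr (Eventually.of_forall fun t => by simp)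
  | succ n ih =>
    intro h hh
    -- The derivative is (n+1)(t^n + h'/(n+1)) with h'/(n+1) again in H, so the exponent drops.
    have h1 := (ih ((hh.deriv hH).mul ((natCast (n + 1)).inv hH)))
    have h2 : EventuallySigned (fun _ : ℝ => ((n + 1 : ℕ) : ℝ)) :=
      Or.inl (Eventually.of_forall fun _ => by positivity)
    refine EventuallySigned.of_hasDerivAt (w := fun t => ((n + 1 : ℕ) : ℝ) * t ^ n + _root_.deriv h t)
      ?_ ((h2.mul h1).congr (Eventually.of_forall fun t => ?_))
    · filter_upwards [hh.hasDerivAt hH] with t ht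
      exact (hasDerivAt_pow (n + 1) t).add ht
    · have : ((n + 1 : ℕ) : ℝ) ≠ 0 := by positivity
      simp only
      field_simp

/-- `t log t + h(t)` is eventually of constant sign when `h` belongs to a Hardy field. -/
theorem eventuallySigned_mul_log_add (hH : IsHardyField H) (hh : GermMem H h) :
    EventuallySigned (fun t => t * Real.log t + h t) := by
  set h1 := _root_.deriv h with h1def
  set h2 := _root_.deriv h1 with h2def
  have m1 : GermMem H h1 := hh.deriv hH
  have m2 : GermMem H h2 := m1.deriv hH
  -- The second derivative of t log t + h is t⁻¹(1 + t h''). Unless h'' vanishes, 1 + t h'' = h''(t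
  -- + 1/h''), which is settled by the case n = 1 of `eventuallySigned_pow_add`.
  have s3 : EventuallySigned (fun t => 1 + t * h2 t) := by
    by_cases hz : ∀ᶠ t in atTop, h2 t = 0
    · exact Or.inl (hz.mono fun t ht => by simp [ht])
    · have hne : ∀ᶠ t in atTop, h2 t ≠ 0 := by
        rcases m2.eventuallySigned hH with h | h | h
        · exact h.mono fun t ht => ht.ne'
        · exact absurd h hz
        · exact h.mono fun t ht => ht.ne
      refine ((m2.eventuallySigned hH).mul (eventuallySigned_pow_add hH 1 (m2.inv hH))).congr ?_
      filter_upwards [hne] with t ht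
      field_simp
      ring
  have s2 : EventuallySigned (fun t => t⁻¹ + h2 t) := by
    have hpos : EventuallySigned (fun t : ℝ => t⁻¹) :=
      Or.inl ((eventually_gt_atTop 0).mono fun t ht => inv_pos.2 ht)
    refine (hpos.mul s3).congr ((eventually_gt_atTop 0).mono fun t ht => ?_)
    have : t ≠ 0 := ht.ne'
    field_simp
  have s1 : EventuallySigned (fun t => Real.log t + 1 + h1 t) := by
    refine EventuallySigned.of_hasDerivAt ?_ s2
    filter_upwards [m1.hasDerivAt hH, eventually_gt_atTop 0] with t ht h0
    exact ((Real.hasDerivAt_log h0.ne').add_const 1).add ht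
  refine EventuallySigned.of_hasDerivAt ?_ s1
  filter_upwards [hh.hasDerivAt hH, eventually_gt_atTop 0] with t ht h0
  have := ((hasDerivAt_id t).mul (Real.hasDerivAt_log h0.ne')).add ht
  refine this.congr_deriv ?_
  rw [one_mul, id, mul_inv_cancel₀ h0.ne']

end GermMem

/-! ### Integrating inequalities between derivatives -/

theorem abs_sub_le_sub_of_abs_deriv_le {L G p g : ℝ → ℝ} {a : ℝ}
    (hL : ∀ t, a ≤ t → HasDerivAt L (p t) t) (hG : ∀ t, a ≤ t → HasDerivAt G (g t) t)
    (hpg : ∀ t, a ≤ t → |p t| ≤ g t) {x y : ℝ} (hx : a ≤ x) (hxy : x ≤ y) :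
    |L y - L x| ≤ G y - G x := by
  have key : ∀ {K : ℝ → ℝ} {k : ℝ → ℝ}, (∀ t, a ≤ t → HasDerivAt K (k t) t) →
      (∀ t, a ≤ t → 0 ≤ k t) → K x ≤ K y := by
    intro K k hK hk
    refine monotoneOn_of_deriv_nonneg (convex_Ici a)
      (fun t ht => (hK t ht).continuousAt.continuousWithinAt) (fun t ht => ?_) (fun t ht => ?_)
      hx (hx.trans hxy) hxy
    · rw [interior_Ici] at ht
      exact (hK t ht.le).differentiableAt.differentiableWithinAt
    · rw [interior_Ici] at ht
      rw [(hK t ht.le).deriv]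
      exact hk t ht.le
  have h1 := key (fun t ht => (hG t ht).sub (hL t ht))
    fun t ht => sub_nonneg.2 ((le_abs_self _).trans (hpg t ht))
  have h2 := key (fun t ht => (hG t ht).add (hL t ht))
    fun t ht => by have := (neg_abs_le (p t)); have := hpg t ht; linarith
  simp only [Pi.sub_apply, Pi.add_apply] at h1 h2
  rw [abs_le]
  constructor <;> linarith

theorem abs_le_add_of_abs_deriv_le {L G p g : ℝ → ℝ}
    (hL : ∀ᶠ t in atTop, HasDerivAt L (p t) t) (hG : ∀ᶠ t in atTop, HasDerivAt G (g t) t)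
    (hpg : ∀ᶠ t in atTop, |p t| ≤ g t) :
    ∃ C, ∀ᶠ t in atTop, |L t| ≤ G t + C := by
  obtain ⟨a, ha⟩ := eventually_atTop.1 (hL.and (hG.and hpg))
  refine ⟨|L a| - G a, (eventually_ge_atTop a).mono fun t ht => ?_⟩
  have h := abs_sub_le_sub_of_abs_deriv_le (fun t ht => (ha t ht).1) (fun t ht => (ha t ht).2.1)
    (fun t ht => (ha t ht).2.2) le_rfl ht
  have := abs_sub_abs_le_abs_sub (L t) (L a)
  linarith

theorem le_abs_add_of_le_abs_deriv {L G p g : ℝ → ℝ}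
    (hL : ∀ᶠ t in atTop, HasDerivAt L (p t) t) (hG : ∀ᶠ t in atTop, HasDerivAt G (g t) t)
    (hp : EventuallySigned p) (hg : ∀ᶠ t in atTop, 0 ≤ g t)
    (hpg : ∀ᶠ t in atTop, g t ≤ |p t|) :
    ∃ C, ∀ᶠ t in atTop, G t ≤ |L t| + C := by
  have key : ∀ {L p : ℝ → ℝ}, (∀ᶠ t in atTop, HasDerivAt L (p t) t) →
      (∀ᶠ t in atTop, g t ≤ |p t|) → (∀ᶠ t in atTop, 0 ≤ p t) →
      ∃ C, ∀ᶠ t in atTop, G t ≤ |L t| + C := by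
    intro L p hL hpg hp
    obtain ⟨C, hC⟩ := abs_le_add_of_abs_deriv_le hG hL
      (by filter_upwards [hg, hpg, hp] with t h1 h2 h3
          rwa [abs_of_nonneg h1, ← abs_of_nonneg h3])
    refine ⟨C, hC.mono fun t ht => ?_⟩
    have := le_abs_self (G t)
    have := le_abs_self (L t)
    linarith
  rcases hp with hp | hp | hp
  · exact key hL hpg (hp.mono fun t h => h.le)
  · exact key hL hpg (hp.mono fun t h => h.ge)
  · obtain ⟨C, hC⟩ := key (L := fun t => -L t) (p := fun t => -p t) (hL.mono fun t h => h.neg)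
      (hpg.mono fun t h => by rwa [abs_neg]) (hp.mono fun t h => by linarith)
    exact ⟨C, hC.mono fun t h => by rwa [abs_neg] at h⟩

/-- `|u|` does not stay between two positive constants near `+∞`. -/
def EscapesAnnuli (u : ℝ → ℝ) : Prop :=
  ∀ c C : ℝ, 0 < c → ¬ ∀ᶠ t in atTop, c ≤ |u t| ∧ |u t| ≤ C

theorem exists_pow_bounds_of_deriv {g g' : ℝ → ℝ} {n : ℕ}
    (hg : ∀ᶠ t in atTop, HasDerivAt g (g' t) t) (hs : EventuallySigned g')
    (h : ∃ c C : ℝ, 0 < c ∧ ∀ᶠ t in atTop, c * t ^ n ≤ |g' t| ∧ |g' t| ≤ C * t ^ n) :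
    ∃ c C : ℝ, 0 < c ∧ ∀ᶠ t in atTop, c * t ^ (n + 1) ≤ |g t| ∧ |g t| ≤ C * t ^ (n + 1) := by
  obtain ⟨c, C, hc, h⟩ := h
  have hn : ((n + 1 : ℕ) : ℝ) ≠ 0 := by positivity
  have hder : ∀ c : ℝ, ∀ t : ℝ,
      HasDerivAt (fun t => c / ((n + 1 : ℕ) : ℝ) * t ^ (n + 1)) (c * t ^ n) t := by
    intro c t
    refine ((hasDerivAt_pow (n + 1) t).const_mul (c / ((n + 1 : ℕ) : ℝ))).congr_deriv ?_
    simp only [Nat.add_sub_cancel]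
    field_simp
  obtain ⟨C1, h1⟩ := abs_le_add_of_abs_deriv_le hg (Eventually.of_forall (hder C))
    (h.mono fun t ht => ht.2)
  obtain ⟨C2, h2⟩ := le_abs_add_of_le_abs_deriv hg (Eventually.of_forall (hder c)) hs
    ((eventually_ge_atTop 0).mono fun t ht => by positivity) (h.mono fun t ht => ht.1)
  refine ⟨c / ((n + 1 : ℕ) : ℝ) / 2, C / ((n + 1 : ℕ) : ℝ) + |C1|, by positivity, ?_⟩
  have hlarge : ∀ᶠ t : ℝ in atTop, C2 ≤ c / ((n + 1 : ℕ) : ℝ) / 2 * t ^ (n + 1) :=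
    ((tendsto_pow_atTop (α := ℝ) (Nat.succ_ne_zero n)).const_mul_atTop
      (by positivity : 0 < c / ((n + 1 : ℕ) : ℝ) / 2)).eventually_ge_atTop C2
  filter_upwards [h1, h2, hlarge, eventually_ge_atTop 1] with t h1 h2 h3 h4
  constructor
  · linarith
  · have : 1 ≤ t ^ (n + 1) := one_le_pow₀ h4
    have h5 : C1 ≤ |C1| * t ^ (n + 1) :=
      (le_abs_self C1).trans (le_mul_of_one_le_right (abs_nonneg _) this)
    linarith

/-! ### Logarithmic derivatives and nonvanishing -/

section HardyGrowth

variable {H : Subring (Germ (atTop : Filter ℝ) ℝ)} {f u : ℝ → ℝ}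

theorem StrictlyBetweenPowers.eventually_bounds (hB : StrictlyBetweenPowers f) :
    ∃ j : ℕ, 1 ≤ j ∧ ∀ A : ℝ, ∀ᶠ t in atTop, 0 < f t ∧ A * t ^ (j - 1) ≤ f t ∧ A * f t ≤ t ^ j := by
  obtain ⟨j, hj, h1, h2⟩ := hB
  refine ⟨j, hj, fun A => ?_⟩
  filter_upwards [h1.eventually_ge_atTop A, h1.eventually_gt_atTop 0, h2.eventually_ge_atTop A,
    eventually_gt_atTop 0] with t e1 e2 e3 e4
  have hp : 0 < t ^ (j - 1) := by positivity
  have hf : 0 < f t := (div_pos_iff_of_pos_right hp).1 e2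
  exact ⟨hf, (le_div_iff₀ hp).1 e1, (le_div_iff₀ hf).1 e3⟩

/-- If |f^(m)| stayed between positive constants, m integrations would make f comparable to t^m,
which strict betweenness excludes. -/
theorem escapesAnnuli_iteratedDeriv (hH : IsHardyField H) (hf : GermMem H f)
    (hB : StrictlyBetweenPowers f) (m : ℕ) : EscapesAnnuli (iteratedDeriv m f) := by
  intro c C hc h
  have step : ∀ j ≤ m, ∃ c C : ℝ, 0 < c ∧ ∀ᶠ t in atTop,
      c * t ^ j ≤ |iteratedDeriv (m - j) f t| ∧ |iteratedDeriv (m - j) f t| ≤ C * t ^ j := by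
    intro j
    induction j with
    | zero => exact fun _ => ⟨c, C, hc, by simpa using h⟩
    | succ j ih =>
      intro hj
      have e : m - j = m - (j + 1) + 1 := by omega
      have ih := ih (by omega)
      rw [e] at ih
      refine exists_pow_bounds_of_deriv (g' := iteratedDeriv (m - (j + 1) + 1) f) ?_
        ((hf.iteratedDeriv hH _).eventuallySigned hH) ih
      have := (hf.iteratedDeriv hH (m - (j + 1))).hasDerivAt hH
      rwa [← iteratedDeriv_succ] at this
  obtain ⟨c, C, hc, h⟩ := step m le_rfl
  simp only [Nat.sub_self, iteratedDeriv_zero] at h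
  obtain ⟨j, hj, hA⟩ := hB.eventually_bounds
  obtain ⟨t, ht, ⟨h0, hA1, -⟩, ⟨-, -, hA2⟩, ht1⟩ := (h.and ((hA (|C| + 1)).and
    ((hA (1 / c + 1)).and (eventually_ge_atTop 1)))).exists
  rw [abs_of_pos h0] at ht
  have hpos : ∀ n : ℕ, 0 < t ^ n := fun n => by positivity
  rcases le_or_gt m (j - 1) with hm | hm
  · have h1 : C * t ^ m ≤ |C| * t ^ (j - 1) :=
      mul_le_mul (le_abs_self C) (pow_le_pow_right₀ ht1 hm) (hpos _).le (abs_nonneg _)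
    nlinarith [hpos (j - 1)]
  · have h1 : t ^ j ≤ t ^ m := pow_le_pow_right₀ ht1 (by omega)
    have h2 : t ^ m ≤ 1 / c * f t := by
      rw [one_div, inv_mul_eq_div, le_div_iff₀ hc]
      linarith
    linarith

theorem germMem_logDeriv (hH : IsHardyField H) (hu : GermMem H u) :
    GermMem H (fun t => deriv u t / u t) := by
  simpa only [div_eq_mul_inv] using (hu.deriv hH).mul (hu.inv hH)

theorem hasDerivAt_log_of_germMem (hH : IsHardyField H) (hu : GermMem H u)
    (hne : ∀ᶠ t in atTop, u t ≠ 0) :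
    ∀ᶠ t in atTop, HasDerivAt (fun t => Real.log (u t)) (deriv u t / u t) t := by
  filter_upwards [hu.hasDerivAt hH, hne] with t h1 h2 using h1.log h2

theorem EscapesAnnuli.not_abs_log_le (hu : EscapesAnnuli u) (hne : ∀ᶠ t in atTop, u t ≠ 0)
    (C : ℝ) : ¬ ∀ᶠ t in atTop, |Real.log (u t)| ≤ C := by
  intro h
  refine hu (Real.exp (-C)) (Real.exp C) (Real.exp_pos _) ?_
  filter_upwards [h, hne] with t h1 h2
  rw [← Real.exp_log_eq_abs h2, Real.exp_le_exp, Real.exp_le_exp]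
  exact abs_le.1 h1

/-- Otherwise u'/u would be dominated by an integrable power of t, so log |u| would be bounded and
|u| trapped in an annulus. -/
theorem rpow_neg_le_abs_logDeriv (hH : IsHardyField H) (hu : GermMem H u)
    (hne : ∀ᶠ t in atTop, u t ≠ 0) (hesc : EscapesAnnuli u) {ε : ℝ} (hε : 0 < ε) :
    ∀ᶠ t in atTop, t ^ (-(1 + ε)) ≤ |deriv u t / u t| := by
  obtain ⟨n, hn⟩ := exists_nat_one_div_lt hε
  set N := n + 1 with hN
  set δ : ℝ := 1 / (N : ℝ) with hδ
  have hNne : N ≠ 0 := Nat.succ_ne_zero n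
  have hN0 : (0 : ℝ) < N := by positivity
  have hδ0 : 0 < δ := by positivity
  have hδε : δ < ε := by rw [hδ, hN]; push_cast; exact hn
  have hp := germMem_logDeriv hH hu
  set p : ℝ → ℝ := fun t => deriv u t / u t with hpdef
  -- With δ = 1/N the N-th power of t^(-(1+δ)) is an integer power, so |p| is compared with it
  -- through the sign of t^(N+1) - |p|^(-N), whose second term lies in H.
  have hpow : ∀ t : ℝ, 0 < t → (t ^ (-(1 + δ))) ^ N = (t ^ (N + 1))⁻¹ := by
    intro t ht
    rw [← Real.rpow_natCast, ← Real.rpow_mul ht.le, ← Real.rpow_natCast, ← Real.rpow_neg ht.le]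
    congr 1
    rw [hδ]; push_cast; field_simp
  have hnot : ¬ ∀ᶠ t in atTop, |p t| ≤ t ^ (-(1 + δ)) := by
    intro hle
    have hder : ∀ᶠ t : ℝ in atTop,
        HasDerivAt (fun t => (-δ)⁻¹ * t ^ (-δ)) (t ^ (-(1 + δ))) t := by
      filter_upwards [eventually_gt_atTop 0] with t ht
      refine ((Real.hasDerivAt_rpow_const (p := -δ) (Or.inl ht.ne')).const_mul (-δ)⁻¹).congr_deriv ?_
      rw [← mul_assoc, inv_mul_cancel₀ (by linarith), one_mul]
      congr 1; ring
    obtain ⟨C, hC⟩ := abs_le_add_of_abs_deriv_le (hasDerivAt_log_of_germMem hH hu hne) hder hle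
    refine hesc.not_abs_log_le hne C ?_
    filter_upwards [hC, eventually_gt_atTop 0] with t h1 h2
    have : (-δ)⁻¹ * t ^ (-δ) ≤ 0 :=
      mul_nonpos_of_nonpos_of_nonneg (inv_nonpos.2 (by linarith)) (Real.rpow_nonneg h2.le _)
    linarith
  have hpne : ∀ᶠ t in atTop, p t ≠ 0 := by
    rcases hp.eventuallySigned hH with h | h | h
    · exact h.mono fun t ht => ht.ne'
    · refine absurd ?_ hnot
      filter_upwards [h, eventually_ge_atTop 0] with t h1 h2
      rw [h1, abs_zero]
      exact Real.rpow_nonneg h2 _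
    · exact h.mono fun t ht => ht.ne
  have hle : EventuallySigned (fun t => t ^ (N + 1) + -(|p t| ^ N)⁻¹) :=
    GermMem.eventuallySigned_pow_add hH (N + 1) (((hp.abs hH).pow N).inv hH).neg
  have aux : (∀ᶠ t in atTop, t ^ (N + 1) + -(|p t| ^ N)⁻¹ ≤ 0) → False := by
    intro h
    refine hnot ?_
    filter_upwards [h, hpne, eventually_gt_atTop 0] with t h1 h2 h3
    have hp0 : 0 < |p t| := abs_pos.2 h2
    rw [← pow_le_pow_iff_left₀ hp0.le (Real.rpow_nonneg h3.le _) hNne,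
      hpow t h3, le_inv_comm₀ (by positivity) (by positivity)]
    linarith
  rcases hle with h | h | h
  · filter_upwards [h, hpne, eventually_ge_atTop 1] with t h1 h2 h3
    have hp0 : 0 < |p t| := abs_pos.2 h2
    have ht0 : 0 < t := by linarith
    calc t ^ (-(1 + ε)) ≤ t ^ (-(1 + δ)) := Real.rpow_le_rpow_of_exponent_le h3 (by linarith)
      _ ≤ |p t| := by
        rw [← pow_le_pow_iff_left₀ (Real.rpow_nonneg ht0.le _) hp0.le hNne,
          hpow t ht0, inv_le_comm₀ (by positivity) (by positivity)]
        linarith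
  · exact (aux (h.mono fun t ht => ht.le)).elim
  · exact (aux (h.mono fun t ht => ht.le)).elim

/-- If |u'/u| exceeded (B+1)/t for all large t, integration would give |log u| ≥ (B+1) log t - C,
more than B log t allows. -/
theorem exists_mul_abs_logDeriv_le (hH : IsHardyField H) (hu : GermMem H u)
    (hne : ∀ᶠ t in atTop, u t ≠ 0) {B : ℕ}
    (hB : ∀ᶠ t in atTop, |Real.log (u t)| ≤ B * Real.log t) :
    ∀ᶠ t in atTop, t * |deriv u t / u t| ≤ B + 1 := by
  have hp := germMem_logDeriv hH hu
  have hdl := hasDerivAt_log_of_germMem hH hu hne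
  set p : ℝ → ℝ := fun t => deriv u t / u t with hpdef
  have hs : EventuallySigned (fun t => t ^ 1 + -(((B + 1 : ℕ) : ℝ) * (|p t|)⁻¹)) :=
    GermMem.eventuallySigned_pow_add hH 1 ((GermMem.natCast (B + 1)).mul ((hp.abs hH).inv hH)).neg
  have aux : (∀ᶠ t in atTop, t ^ 1 + -(((B + 1 : ℕ) : ℝ) * (|p t|)⁻¹) ≤ 0) →
      ∀ᶠ t in atTop, t * |p t| ≤ B + 1 := by
    intro h
    filter_upwards [h] with t h1
    rcases (abs_nonneg (p t)).eq_or_lt with h2 | h2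
    · rw [← h2]; simp; positivity
    · rw [← div_eq_mul_inv, pow_one] at h1
      rw [← le_div_iff₀ h2]
      push_cast at h1
      linarith
  rcases hs with h | h | h
  · by_contra hcon
    have hpne : ∀ᶠ t in atTop, p t ≠ 0 := by
      rcases hp.eventuallySigned hH with h | h | h
      · exact h.mono fun t ht => ht.ne'
      · refine absurd ?_ hcon
        filter_upwards [h] with t h1
        have : deriv u t / u t = 0 := h1
        rw [this]; simp; positivity
      · exact h.mono fun t ht => ht.ne
    have hder : ∀ᶠ t : ℝ in atTop,
        HasDerivAt (fun t => ((B + 1 : ℕ) : ℝ) * Real.log t) (((B + 1 : ℕ) : ℝ) * t⁻¹) t := by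
      filter_upwards [eventually_gt_atTop 0] with t ht
      exact (Real.hasDerivAt_log ht.ne').const_mul _
    obtain ⟨C, hC⟩ := le_abs_add_of_le_abs_deriv hdl hder (hp.eventuallySigned hH)
      ((eventually_ge_atTop 0).mono fun t ht => by positivity) (by
        filter_upwards [h, hpne, eventually_gt_atTop 0] with t h1 h2 h3
        have h4 : 0 < |p t| := abs_pos.2 h2
        rw [pow_one, ← div_eq_mul_inv, ← sub_eq_add_neg, sub_pos, div_lt_iff₀ h4] at h1
        rw [← div_eq_mul_inv, div_le_iff₀ h3]
        have : |p t| = |deriv u t / u t| := rfl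
        rw [← this]; linarith)
    obtain ⟨t, h1, h2, h3⟩ := (hC.and (hB.and
      (Real.tendsto_log_atTop.eventually_gt_atTop C))).exists
    push_cast at h1
    linarith
  · exact aux (h.mono fun t ht => ht.le)
  · exact aux (h.mono fun t ht => ht.le)

theorem iteratedDeriv_ne_zero_and_abs_log_le (hH : IsHardyField H) (hf : GermMem H f)
    (hB : StrictlyBetweenPowers f) (m : ℕ) :
    (∀ᶠ t in atTop, iteratedDeriv m f t ≠ 0) ∧
      ∃ B : ℕ, ∀ᶠ t in atTop, |Real.log (iteratedDeriv m f t)| ≤ B * Real.log t := by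
  induction m with
  | zero =>
    obtain ⟨j, hj, hA⟩ := hB.eventually_bounds
    simp only [iteratedDeriv_zero]
    refine ⟨(hA 1).mono fun t ht => ht.1.ne', j, ?_⟩
    filter_upwards [hA 1, eventually_ge_atTop 1] with t ⟨h1, h2, h3⟩ h4
    have h5 : 1 ≤ f t := by
      have := one_le_pow₀ h4 (n := j - 1)
      linarith
    rw [abs_of_nonneg (Real.log_nonneg h5), ← Real.log_pow]
    exact Real.log_le_log h1 (by linarith)
  | succ m ih =>
    obtain ⟨hne, B, hBd⟩ := ih
    have hu := hf.iteratedDeriv hH m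
    have hlow := rpow_neg_le_abs_logDeriv hH hu hne (escapesAnnuli_iteratedDeriv hH hf hB m)
      one_pos
    have hup := exists_mul_abs_logDeriv_le hH hu hne hBd
    rw [iteratedDeriv_succ]
    have hpos : ∀ᶠ t in atTop, deriv (iteratedDeriv m f) t / iteratedDeriv m f t ≠ 0 := by
      filter_upwards [hlow, eventually_gt_atTop 0] with t h1 h2
      exact abs_pos.1 ((Real.rpow_pos_of_pos h2 _).trans_le h1)
    -- The new factor q = u'/u satisfies -2 log t ≤ log q ≤ log t, so it adds at most 3 log t.
    refine ⟨hpos.mono fun t ht h => ht (by rw [h, zero_div]), B + 3, ?_⟩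
    filter_upwards [hlow, hup, hpos, hne, hBd, eventually_ge_atTop 1,
      eventually_ge_atTop ((B : ℝ) + 1)] with t h1 h2 h3 h4 h5 h6 h7
    have ht : 0 < t := by linarith
    set q := deriv (iteratedDeriv m f) t / iteratedDeriv m f t with hq
    have e : deriv (iteratedDeriv m f) t = q * iteratedDeriv m f t := by
      rw [hq, div_mul_cancel₀ _ h4]
    have hq0 : 0 < |q| := abs_pos.2 h3
    have hl1 : -2 * Real.log t ≤ Real.log q := by
      rw [← Real.log_abs q]
      have := Real.log_le_log (Real.rpow_pos_of_pos ht _) h1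
      rw [Real.log_rpow ht] at this
      linarith
    have hl2 : Real.log q ≤ Real.log t := by
      rw [← Real.log_abs q]
      refine Real.log_le_log hq0 ?_
      have : 1 * |q| ≤ t * |q| := by gcongr
      linarith
    have hlt : 0 ≤ Real.log t := Real.log_nonneg h6
    rw [e, Real.log_mul h3 h4]
    have h8 : |Real.log q| ≤ 3 * Real.log t := by rw [abs_le]; constructor <;> linarith
    have := abs_add_le (Real.log q) (Real.log (iteratedDeriv m f t))
    push_cast
    linarith

end HardyGrowth

/-! ### Sizes of derivatives and of their ratios -/

section HardyBounds

variable {H : Subring (Germ (atTop : Filter ℝ) ℝ)} {f u w : ℝ → ℝ}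

theorem exists_abs_iteratedDeriv_le (hH : IsHardyField H) (hf : GermMem H f)
    (hB : StrictlyBetweenPowers f) (m : ℕ) :
    ∃ C : ℝ, 0 < C ∧ ∀ᶠ t in atTop, |iteratedDeriv m f t| * t ^ m ≤ C * f t := by
  induction m with
  | zero =>
    obtain ⟨j, -, hA⟩ := hB.eventually_bounds
    refine ⟨1, one_pos, (hA 1).mono fun t ht => ?_⟩
    simp [abs_of_pos ht.1]
  | succ m ih =>
    obtain ⟨C, hC, ih⟩ := ih
    obtain ⟨hne, B, hBd⟩ := iteratedDeriv_ne_zero_and_abs_log_le hH hf hB m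
    refine ⟨(B + 1) * C, by positivity, ?_⟩
    filter_upwards [ih, hne, exists_mul_abs_logDeriv_le hH (hf.iteratedDeriv hH m) hne hBd,
      eventually_gt_atTop 0] with t h1 h2 h3 h4
    rw [← iteratedDeriv_succ, abs_div, ← mul_div_assoc, div_le_iff₀ (abs_pos.2 h2)] at h3
    calc |iteratedDeriv (m + 1) f t| * t ^ (m + 1)
        = (t * |iteratedDeriv (m + 1) f t|) * t ^ m := by ring
      _ ≤ ((B + 1) * |iteratedDeriv m f t|) * t ^ m := by gcongr
      _ = (B + 1) * (|iteratedDeriv m f t| * t ^ m) := by ring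
      _ ≤ (B + 1) * (C * f t) := by gcongr
      _ = _ := by ring

/-- Each differentiation multiplies by a logarithmic derivative of size at least t^(-1-ε/2); the
other half of ε is left for the earlier ones. -/
theorem eventually_le_abs_iteratedDeriv (hH : IsHardyField H) (hf : GermMem H f)
    (hB : StrictlyBetweenPowers f) (m : ℕ) {ε : ℝ} (hε : 0 < ε) :
    ∀ᶠ t in atTop, f t * t ^ (-ε) ≤ |iteratedDeriv m f t| * t ^ m := by
  induction m generalizing ε with
  | zero =>
    obtain ⟨j, -, hA⟩ := hB.eventually_bounds
    filter_upwards [hA 1, eventually_ge_atTop 1] with t ht h1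
    simp only [iteratedDeriv_zero, pow_zero, mul_one, abs_of_pos ht.1]
    exact mul_le_of_le_one_right ht.1.le (Real.rpow_le_one_of_one_le_of_nonpos h1 (by linarith))
  | succ m ih =>
    obtain ⟨hne, -⟩ := iteratedDeriv_ne_zero_and_abs_log_le hH hf hB m
    filter_upwards [ih (half_pos hε), hne, rpow_neg_le_abs_logDeriv hH (hf.iteratedDeriv hH m) hne
      (escapesAnnuli_iteratedDeriv hH hf hB m) (half_pos hε), eventually_gt_atTop 0]
      with t h1 h2 h3 h4
    rw [← iteratedDeriv_succ, abs_div, le_div_iff₀ (abs_pos.2 h2)] at h3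
    have e1 : t ^ (-ε) = t ^ (-(ε / 2)) * t ^ (-(1 + ε / 2)) * t := by
      nth_rewrite 4 [← Real.rpow_one t]
      rw [← Real.rpow_add h4, ← Real.rpow_add h4]
      congr 1; ring
    have hr : 0 ≤ t ^ (-(1 + ε / 2)) := Real.rpow_nonneg h4.le _
    calc f t * t ^ (-ε) = (f t * t ^ (-(ε / 2))) * (t ^ (-(1 + ε / 2)) * t) := by rw [e1]; ring
      _ ≤ (|iteratedDeriv m f t| * t ^ m) * (t ^ (-(1 + ε / 2)) * t) := by gcongr
      _ = (t ^ (-(1 + ε / 2)) * |iteratedDeriv m f t|) * t ^ (m + 1) := by ring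
      _ ≤ _ := by gcongr

theorem StrictlyBetweenPowers.eventually_ge (hB : StrictlyBetweenPowers f) (A : ℝ) :
    ∀ᶠ t in atTop, A ≤ f t := by
  obtain ⟨j, -, hA⟩ := hB.eventually_bounds
  filter_upwards [hA |A|, eventually_ge_atTop 1] with t ht h1
  have h2 : |A| ≤ |A| * t ^ (j - 1) := le_mul_of_one_le_right (abs_nonneg _) (one_le_pow₀ h1)
  exact (le_abs_self A).trans (h2.trans ht.2.1)

/-- Were f'/f at most 1/(t log t) for all large t, integration would give log f ≤ log log t + C,
against the growth hypothesis on log f. -/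
theorem eventually_le_deriv_mul (hH : IsHardyField H) (hf : GermMem H f)
    (hB : StrictlyBetweenPowers f)
    (hlog : GrowthLT (fun t => Real.log (Real.log t)) (fun t => Real.log (f t))) :
    ∀ᶠ t in atTop, f t ≤ deriv f t * (t * Real.log t) := by
  have hpos : ∀ᶠ t in atTop, 0 < f t := (hB.eventually_ge 1).mono fun t ht => by linarith
  have hdl := hasDerivAt_log_of_germMem hH hf (hpos.mono fun t ht => ht.ne')
  have hll : ∀ᶠ t in atTop, HasDerivAt (fun t => Real.log (Real.log t)) (t⁻¹ / Real.log t) t := by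
    filter_upwards [eventually_gt_atTop 1] with t ht
    exact (Real.hasDerivAt_log (by linarith)).log (Real.log_pos ht).ne'
  have hllt : Tendsto (fun t => Real.log (Real.log t)) atTop atTop :=
    Real.tendsto_log_atTop.comp Real.tendsto_log_atTop
  have hnot : ¬ ∀ᶠ t in atTop, |deriv f t / f t| ≤ t⁻¹ / Real.log t := by
    intro h
    obtain ⟨C, hC⟩ := abs_le_add_of_abs_deriv_le hdl hll h
    obtain ⟨t, h1, h2, h3, h4⟩ := (hC.and ((hlog.eventually_ge_atTop 2).and
      ((hllt.eventually_gt_atTop C).and (hllt.eventually_gt_atTop 0)))).exists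
    rw [le_div_iff₀ h4] at h2
    have := le_abs_self (Real.log (f t))
    linarith
  have hdpos : ∀ᶠ t in atTop, 0 < deriv f t := by
    have h0 : ¬ ∀ᶠ t in atTop, deriv f t ≤ 0 := by
      intro h
      obtain ⟨C, hC⟩ := abs_le_add_of_abs_deriv_le (L := fun _ : ℝ => (0 : ℝ)) (p := fun _ => 0)
        (Eventually.of_forall fun t => hasDerivAt_const t (0 : ℝ))
        ((hf.hasDerivAt hH).mono fun t ht => ht.neg) (h.mono fun t ht => by simpa using ht)
      obtain ⟨t, h1, h2⟩ := (hC.and (hB.eventually_ge (C + 1))).exists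
      simp at h1
      linarith
    rcases (hf.deriv hH).eventuallySigned hH with h | h | h
    · exact h
    · exact absurd (h.mono fun t ht => ht.le) h0
    · exact absurd (h.mono fun t ht => ht.le) h0
  have hs : EventuallySigned (fun t => t * Real.log t + -(f t * (deriv f t)⁻¹)) :=
    GermMem.eventuallySigned_mul_log_add hH (hf.mul ((hf.deriv hH).inv hH)).neg
  have aux : (∀ᶠ t in atTop, t * Real.log t + -(f t * (deriv f t)⁻¹) ≤ 0) → False := by
    intro h
    refine hnot ?_
    filter_upwards [h, hpos, hdpos, eventually_gt_atTop 1] with t h1 h2 h3 h4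
    have hl := Real.log_pos h4
    rw [← div_eq_mul_inv, ← sub_eq_add_neg, sub_nonpos, le_div_iff₀ h3] at h1
    have h5 : (0 : ℝ) < t := by linarith
    rw [abs_of_pos (div_pos h3 h2), div_le_div_iff₀ h2 hl, ← div_eq_inv_mul, le_div_iff₀ h5]
    linarith
  rcases hs with h | h | h
  · filter_upwards [h, hdpos] with t h1 h3
    rw [← div_eq_mul_inv, ← sub_eq_add_neg, sub_pos, div_lt_iff₀ h3] at h1
    linarith
  · exact (aux (h.mono fun t ht => ht.le)).elim
  · exact (aux (h.mono fun t ht => ht.le)).elim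

theorem eventually_forall_ge_le (hH : IsHardyField H) (hf : GermMem H f)
    (hB : StrictlyBetweenPowers f)
    (hlog : GrowthLT (fun t => Real.log (Real.log t)) (fun t => Real.log (f t))) :
    ∀ᶠ y in atTop, ∀ t, y ≤ t → f y ≤ f t := by
  obtain ⟨a, ha⟩ := eventually_atTop.1 ((eventually_le_deriv_mul hH hf hB hlog).and
    ((eventually_gt_atTop 1).and ((hB.eventually_ge 1).and (hf.hasDerivAt hH))))
  refine (eventually_ge_atTop a).mono fun y hy t hyt => ?_
  have := abs_sub_le_sub_of_abs_deriv_le (L := fun _ => (0 : ℝ)) (p := fun _ => 0) (a := a)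
    (fun t _ => hasDerivAt_const t (0 : ℝ)) (fun t ht => (ha t ht).2.2.2) (fun t ht => by
      obtain ⟨h1, h2, h3, -⟩ := ha t ht
      have h4 : 0 < t * Real.log t := mul_pos (by linarith) (Real.log_pos h2)
      simpa using (pos_of_mul_pos_left (by linarith : 0 < deriv f t * (t * Real.log t)) h4.le).le)
    hy hyt
  simp at this
  linarith

/-- The logarithmic derivative is at most (B+1)/t; integrating over [y, 4y] gives the factor
4^(B+1). -/
theorem exists_doubling (hH : IsHardyField H) (hf : GermMem H f)
    (hB : StrictlyBetweenPowers f) :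
    ∃ C : ℝ, 0 < C ∧ ∀ᶠ y in atTop, ∀ t, y ≤ t → t ≤ 4 * y → f t ≤ C * f y := by
  have hpos : ∀ᶠ t in atTop, 0 < f t := (hB.eventually_ge 1).mono fun t ht => by linarith
  have hne := hpos.mono fun t ht => ht.ne'
  obtain ⟨B, hBd⟩ := (iteratedDeriv_ne_zero_and_abs_log_le hH hf hB 0).2
  rw [iteratedDeriv_zero] at hBd
  obtain ⟨a, ha⟩ := eventually_atTop.1 ((hasDerivAt_log_of_germMem hH hf hne).and
    ((exists_mul_abs_logDeriv_le hH hf hne hBd).and ((eventually_gt_atTop 1).and hpos)))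
  refine ⟨Real.exp ((B + 1) * Real.log 4), Real.exp_pos _,
    (eventually_ge_atTop a).mono fun y hy t hyt hty => ?_⟩
  obtain ⟨-, -, h1y, hfy⟩ := ha y hy
  have hft := (ha t (hy.trans hyt)).2.2.2
  have h := abs_sub_le_sub_of_abs_deriv_le (G := fun t => ((B : ℝ) + 1) * Real.log t)
    (g := fun t => ((B : ℝ) + 1) * t⁻¹) (fun t ht => (ha t ht).1) (fun t ht =>
      (Real.hasDerivAt_log (by linarith [(ha t ht).2.2.1])).const_mul _) (fun t ht => by
      obtain ⟨-, h1, h2, -⟩ := ha t ht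
      rw [← div_eq_mul_inv, le_div_iff₀ (by linarith)]
      linarith) hy hyt
  have h2 : Real.log t ≤ Real.log 4 + Real.log y := by
    rw [← Real.log_mul (by norm_num) (by linarith)]
    exact Real.log_le_log (by linarith) hty
  have h3 := (le_abs_self _).trans h
  have h4 : Real.log (f t) ≤ (B + 1) * Real.log 4 + Real.log (f y) := by
    have : ((B : ℝ) + 1) * Real.log t ≤ (B + 1) * (Real.log 4 + Real.log y) := by gcongr
    linarith
  have h5 := Real.exp_le_exp.2 h4
  rwa [Real.exp_log hft, Real.exp_add, Real.exp_log hfy] at h5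

/-- Passing to derivatives costs a quotient `u / w` tending to infinity only an arbitrarily small
power. -/
theorem eventually_pow_div_le_pow_deriv_div (hH : IsHardyField H) (hu : GermMem H u)
    (hw : GermMem H w) (hune : ∀ᶠ t in atTop, u t ≠ 0) (hwne : ∀ᶠ t in atTop, w t ≠ 0)
    (hwne' : ∀ᶠ t in atTop, deriv w t ≠ 0)
    (huesc : EscapesAnnuli u) (hwesc : EscapesAnnuli w)
    (huw : Tendsto (fun t => |u t / w t|) atTop atTop) (n : ℕ) :
    ∀ᶠ t in atTop, |u t / w t| ^ n ≤ |deriv u t / deriv w t| ^ (n + 1) := by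
  -- For U = |u|^δ and W = |w|^δ with δ = 1/(n+1), the reversed inequality |u'/w'|^(n+1) ≤ |u/w|^n
  -- says exactly that |U'| ≤ |W'|.
  set δ : ℝ := 1 / ((n + 1 : ℕ) : ℝ) with hδ
  have hn0 : ((n + 1 : ℕ) : ℝ) ≠ 0 := by positivity
  have hδ0 : 0 < δ := by positivity
  have hδn : δ * ((n + 1 : ℕ) : ℝ) = 1 := by rw [hδ]; field_simp
  have root : ∀ {v : ℝ → ℝ}, GermMem H v → (∀ᶠ t in atTop, v t ≠ 0) →
      ∀ᶠ t in atTop, HasDerivAt (fun t => |v t| ^ δ) (δ * |v t| ^ δ * (deriv v t / v t)) t := by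
    intro v hv hvne
    obtain ⟨a, ha⟩ := eventually_atTop.1 hvne
    filter_upwards [hasDerivAt_log_of_germMem hH hv hvne, eventually_gt_atTop a] with t h1 h2
    have h3 := (h1.const_mul δ).exp
    have e : ∀ s, v s ≠ 0 → Real.exp (δ * Real.log (v s)) = |v s| ^ δ := by
      intro s hs
      rw [Real.rpow_def_of_pos (abs_pos.2 hs), Real.log_abs, mul_comm]
    rw [e t (ha t h2.le)] at h3
    refine (h3.congr_of_eventuallyEq ?_).congr_deriv (by ring)
    filter_upwards [Ioi_mem_nhds h2] with s hs using (e s (ha s (le_of_lt hs))).symm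
  have hs : EventuallySigned (fun t => |deriv u t / deriv w t| ^ (n + 1) - |u t / w t| ^ n) := by
    simp only [div_eq_mul_inv]
    exact (((((hu.deriv hH).mul ((hw.deriv hH).inv hH)).abs hH).pow (n + 1)).sub
      (((hu.mul (hw.inv hH)).abs hH).pow n)).eventuallySigned hH
  have aux : (∀ᶠ t in atTop, |deriv u t / deriv w t| ^ (n + 1) ≤ |u t / w t| ^ n) → False := by
    intro h
    have hle : ∀ᶠ t in atTop, |δ * |u t| ^ δ * (deriv u t / u t)| ≤
        |δ * |w t| ^ δ * (deriv w t / w t)| := by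
      filter_upwards [h, hune, hwne, hwne'] with t h1 h2 h3 h4
      have hu0 : 0 < |u t| := abs_pos.2 h2
      have hw0 : 0 < |w t| := abs_pos.2 h3
      have hw1 : 0 < |deriv w t| := abs_pos.2 h4
      have hpow : ∀ x : ℝ, 0 < x → (x ^ δ) ^ (n + 1) = x := by
        intro x hx
        rw [← Real.rpow_natCast, ← Real.rpow_mul hx.le, hδn, Real.rpow_one]
      rw [← pow_le_pow_iff_left₀ (abs_nonneg _) (abs_nonneg _) (Nat.succ_ne_zero n)]
      simp only [abs_mul, abs_div, mul_pow, div_pow, Nat.succ_eq_add_one,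
        abs_of_nonneg (Real.rpow_nonneg (abs_nonneg _) _), hpow _ hu0, hpow _ hw0]
      rw [abs_div, abs_div, div_pow, div_pow, div_le_div_iff₀ (by positivity) (by positivity)] at h1
      rw [mul_assoc, mul_assoc]
      refine mul_le_mul_of_nonneg_left ?_ (by positivity)
      rw [← mul_div_assoc, ← mul_div_assoc, div_le_div_iff₀ (by positivity) (by positivity)]
      calc |u t| * |deriv u t| ^ (n + 1) * |w t| ^ (n + 1)
          = |u t| * |w t| * (|deriv u t| ^ (n + 1) * |w t| ^ n) := by ring
        _ ≤ |u t| * |w t| * (|u t| ^ n * |deriv w t| ^ (n + 1)) := by gcongr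
        _ = _ := by ring
    have hbig : ∀ᶠ t in atTop, 2 * |w t| ^ δ ≤ |u t| ^ δ := by
      filter_upwards [huw.eventually_ge_atTop (2 ^ (n + 1)), hune, hwne] with t h1 h2 h3
      have hu0 : 0 < |u t| := abs_pos.2 h2
      have hw0 : 0 < |w t| := abs_pos.2 h3
      rw [abs_div, le_div_iff₀ hw0] at h1
      have := Real.rpow_le_rpow (by positivity) h1 hδ0.le
      rwa [Real.mul_rpow (by positivity) hw0.le, ← Real.rpow_natCast, ← Real.rpow_mul two_pos.le,
        mul_comm _ δ, hδn, Real.rpow_one] at this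
    have unroot : ∀ {v : ℝ → ℝ}, EscapesAnnuli v → ∀ c C : ℝ, 0 < c →
        ¬ ∀ᶠ t in atTop, c ≤ |v t| ^ δ ∧ |v t| ^ δ ≤ C := by
      intro v hv c C hc h
      refine hv (c ^ (n + 1)) (C ^ (n + 1)) (by positivity) (h.mono fun t ht => ?_)
      have e : |v t| = (|v t| ^ δ) ^ (n + 1) := by
        rw [← Real.rpow_natCast, ← Real.rpow_mul (abs_nonneg _), hδn, Real.rpow_one]
      rw [e]
      exact ⟨pow_le_pow_left₀ hc.le ht.1 _,
        pow_le_pow_left₀ (Real.rpow_nonneg (abs_nonneg _) _) ht.2 _⟩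
    have hUd := root hu hune
    have hWd := root hw hwne
    have hWs : EventuallySigned (fun t => deriv w t / w t) :=
      (germMem_logDeriv hH hw).eventuallySigned hH
    have hrp : ∀ᶠ t in atTop, 0 < δ * |w t| ^ δ := by
      filter_upwards [hwne] with t h3
      have := Real.rpow_pos_of_pos (abs_pos.2 h3) δ
      positivity
    -- If W increases, 2W ≤ U ≤ U(a) + W - W(a) keeps W between W(a) and U(a). If W decreases, U
    -- moves from U(a) by at most W(a) ≤ U(a)/2. Either way w or u is trapped in an annulus.
    rcases hWs with hW | hW | hW
    · obtain ⟨a, ha⟩ := eventually_atTop.1 (hUd.and (hWd.and (hle.and (hW.and (hrp.and hbig)))))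
      have hWa : 0 < |w a| ^ δ := by
        have := (ha a le_rfl).2.2.2.2.1
        exact pos_of_mul_pos_right this hδ0.le
      refine unroot hwesc (|w a| ^ δ) (|u a| ^ δ) hWa
        ((eventually_ge_atTop a).mono fun t ht => ?_)
      have h1 := abs_sub_le_sub_of_abs_deriv_le (fun t ht => (ha t ht).1)
        (fun t ht => (ha t ht).2.1) (fun t ht => by
          obtain ⟨-, -, h1, h2, h3, -⟩ := ha t ht
          rwa [abs_of_pos (mul_pos h3 h2)] at h1) le_rfl ht
      have h2 := (ha t ht).2.2.2.2.2
      have h3 := abs_nonneg (|u t| ^ δ - |u a| ^ δ)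
      have h4 := le_abs_self (|u t| ^ δ - |u a| ^ δ)
      constructor <;> linarith
    · refine absurd (hW.and (hwne.and hwne')) ?_
      intro h
      obtain ⟨t, h1, h2, h3⟩ := h.exists
      exact (div_ne_zero h3 h2) h1
    · obtain ⟨a, ha⟩ := eventually_atTop.1 (hUd.and (hWd.and (hle.and (hW.and (hrp.and hbig)))))
      have hWa : ∀ t, a ≤ t → 0 < |w t| ^ δ := fun t ht =>
        pos_of_mul_pos_right (ha t ht).2.2.2.2.1 hδ0.le
      have hUa := (ha a le_rfl).2.2.2.2.2
      have := hWa a le_rfl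
      refine unroot huesc (|u a| ^ δ / 2) (2 * |u a| ^ δ) (by linarith)
        ((eventually_ge_atTop a).mono fun t ht => ?_)
      have h1 := abs_sub_le_sub_of_abs_deriv_le (fun t ht => (ha t ht).1)
        (fun t ht => (ha t ht).2.1.neg) (fun t ht => by
          obtain ⟨-, -, h1, h2, h3, -⟩ := ha t ht
          rwa [abs_of_neg (mul_neg_of_pos_of_neg h3 h2)] at h1) le_rfl ht
      simp only [Pi.neg_apply] at h1
      have h2 := hWa t ht
      have h4 := abs_le.1 h1
      constructor <;> linarith [h4.1, h4.2]
  rcases hs with h | h | h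
  · exact h.mono fun t ht => by linarith
  · exact h.mono fun t ht => by linarith
  · exact (aux (h.mono fun t ht => by linarith)).elim

theorem eventually_rpow_le_iteratedDeriv_div (hH : IsHardyField H) (hu : GermMem H u)
    (hw : GermMem H w) (hBu : StrictlyBetweenPowers u) (hBw : StrictlyBetweenPowers w)
    (huw : GrowthLT (fun t => Real.log (Real.log t) ^ 4) (fun t => u t / w t)) (m : ℕ)
    {a : ℝ} (ha0 : 0 < a) (ha : a < 4) :
    ∀ᶠ t in atTop, Real.log (Real.log t) ^ a ≤ |iteratedDeriv m u t / iteratedDeriv m w t| := by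
  have hllt : Tendsto (fun t => Real.log (Real.log t)) atTop atTop :=
    Real.tendsto_log_atTop.comp Real.tendsto_log_atTop
  induction m generalizing a with
  | zero =>
    filter_upwards [huw.eventually_ge_atTop 1, hllt.eventually_ge_atTop 1] with t h1 h2
    rw [le_div_iff₀ (by positivity), one_mul] at h1
    rw [iteratedDeriv_zero, iteratedDeriv_zero]
    calc Real.log (Real.log t) ^ a ≤ Real.log (Real.log t) ^ (4 : ℝ) :=
          Real.rpow_le_rpow_of_exponent_le h2 ha.le
      _ = Real.log (Real.log t) ^ 4 := by norm_cast
      _ ≤ _ := h1.trans (le_abs_self _)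
  | succ m ih =>
    -- Start from an exponent b strictly between a and 4 and take n with bn ≥ a(n+1): this pays for
    -- the loss in one differentiation.
    set b := (a + 4) / 2 with hb
    obtain ⟨n, hn⟩ := exists_nat_gt (a / (b - a))
    have hba : 0 < b - a := by rw [hb]; linarith
    rw [div_lt_iff₀ hba] at hn
    have h1 := ih (a := b) (by linarith) (by linarith)
    have htend : Tendsto (fun t => |iteratedDeriv m u t / iteratedDeriv m w t|) atTop atTop :=
      tendsto_atTop_mono' _ h1 ((tendsto_rpow_atTop (by linarith)).comp hllt)
    have hne' := (iteratedDeriv_ne_zero_and_abs_log_le hH hw hBw (m + 1)).1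
    rw [iteratedDeriv_succ] at hne'
    have h2 := eventually_pow_div_le_pow_deriv_div hH (hu.iteratedDeriv hH m)
      (hw.iteratedDeriv hH m) (iteratedDeriv_ne_zero_and_abs_log_le hH hu hBu m).1
      (iteratedDeriv_ne_zero_and_abs_log_le hH hw hBw m).1 hne'
      (escapesAnnuli_iteratedDeriv hH hu hBu m) (escapesAnnuli_iteratedDeriv hH hw hBw m) htend n
    filter_upwards [h1, h2, hllt.eventually_ge_atTop 1] with t h1 h2 h3
    rw [← iteratedDeriv_succ, ← iteratedDeriv_succ] at h2
    have h0 : 0 ≤ Real.log (Real.log t) := by linarith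
    rw [← pow_le_pow_iff_left₀ (Real.rpow_nonneg h0 _) (abs_nonneg _) (Nat.succ_ne_zero n)]
    refine le_trans ?_ ((pow_le_pow_left₀ (Real.rpow_nonneg h0 _) h1 n).trans h2)
    rw [← Real.rpow_natCast, ← Real.rpow_natCast, ← Real.rpow_mul h0, ← Real.rpow_mul h0]
    refine Real.rpow_le_rpow_of_exponent_le h3 ?_
    push_cast
    linarith

end HardyBounds

/-! ### The Kusmin–Landau and van der Corput inequalities -/

section ExponentialSums

theorem expTwoPiI_eq (x : ℝ) :
    expTwoPiI x = Complex.exp (Complex.I * ((2 * Real.pi * x : ℝ) : ℂ)) := by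
  unfold expTwoPiI
  congr 1
  push_cast
  ring

theorem norm_expTwoPiI (x : ℝ) : ‖expTwoPiI x‖ = 1 := by
  rw [expTwoPiI_eq, mul_comm, Complex.norm_exp_ofReal_mul_I]

theorem expTwoPiI_add (x y : ℝ) : expTwoPiI (x + y) = expTwoPiI x * expTwoPiI y := by
  unfold expTwoPiI
  rw [← Complex.exp_add]
  congr 1
  push_cast
  ring

theorem conj_expTwoPiI (x : ℝ) : starRingEnd ℂ (expTwoPiI x) = expTwoPiI (-x) := by
  rw [expTwoPiI_eq, expTwoPiI_eq, ← Complex.exp_conj]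
  congr 1
  rw [map_mul, Complex.conj_I, Complex.conj_ofReal]
  push_cast
  ring

theorem norm_expTwoPiI_sub_one_ge {x : ℝ} (h0 : 0 ≤ x) (h1 : x ≤ 1 / 2) :
    4 * x ≤ ‖expTwoPiI x - 1‖ := by
  rw [expTwoPiI_eq, Complex.norm_exp_I_mul_ofReal_sub_one]
  have h := Real.mul_le_sin (x := 2 * Real.pi * x / 2) (by positivity)
    (by nlinarith [Real.pi_pos])
  have e : 2 / Real.pi * (2 * Real.pi * x / 2) = 2 * x := by
    field_simp
  rw [e] at h
  rw [Real.norm_eq_abs]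
  exact le_trans (by linarith) (le_abs_self _)

theorem norm_expTwoPiI_sub_le (x y : ℝ) :
    ‖expTwoPiI x - expTwoPiI y‖ ≤ 2 * Real.pi * |x - y| := by
  have e : expTwoPiI x - expTwoPiI y = expTwoPiI y * (expTwoPiI (x - y) - 1) := by
    rw [mul_sub, ← expTwoPiI_add]
    simp
  rw [e, norm_mul, norm_expTwoPiI, one_mul, expTwoPiI_eq]
  refine Real.norm_exp_I_mul_ofReal_sub_one_le.trans ?_
  rw [Real.norm_eq_abs, abs_mul, abs_of_pos Real.two_pi_pos]

/-- The `q`-th differences of `g` on `[0, K)` lie in `[lo, hi]` and are monotone. -/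
def DifferenceBounds (q K : ℕ) (lo hi : ℝ) (g : ℕ → ℝ) : Prop :=
  (∀ n < K, lo ≤ (fwdDiff 1)^[q] g n ∧ (fwdDiff 1)^[q] g n ≤ hi) ∧
    ((∀ n < K, 0 ≤ (fwdDiff 1)^[q + 1] g n) ∨ ∀ n < K, (fwdDiff 1)^[q + 1] g n ≤ 0)

theorem fwdDiff_iterate_sub (m : ℕ) (g h : ℕ → ℝ) (n : ℕ) :
    (fwdDiff 1)^[m] (fun n => g n - h n) n = (fwdDiff 1)^[m] g n - (fwdDiff 1)^[m] h n := by
  induction m generalizing g h with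
  | zero => rfl
  | succ m ih =>
    simp only [Function.iterate_succ, Function.comp_apply]
    rw [← ih]
    have e : fwdDiff 1 (fun n => g n - h n) = fun n => fwdDiff 1 g n - fwdDiff 1 h n := by
      funext k
      simp only [fwdDiff]
      ring
    rw [e]

theorem fwdDiff_iterate_shift_sub (m h : ℕ) (g : ℕ → ℝ) (n : ℕ) :
    (fwdDiff 1)^[m] (fun n => g (n + h) - g n) n =
      ∑ i ∈ Finset.range h, (fwdDiff 1)^[m + 1] g (n + i) := by
  rw [fwdDiff_iterate_sub m (fun n => g (n + h)) g, fwdDiff_iter_comp_add]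
  simp only [Function.iterate_succ_apply', fwdDiff]
  exact (Finset.sum_range_sub (fun i => (fwdDiff 1)^[m] g (n + i)) h).symm

/-- A q-th difference of the shifted phase is a sum of h consecutive (q+1)-st differences of g,
which accounts for the factor h and for the shortening of the range. -/
theorem DifferenceBounds.shift_sub {q K : ℕ} {lo hi : ℝ} {g : ℕ → ℝ}
    (hg : DifferenceBounds (q + 1) K lo hi g) (h : ℕ) :
    DifferenceBounds q (K - h) (h * lo) (h * hi) (fun n => g (n + h) - g n) := by
  obtain ⟨h1, h2⟩ := hg
  refine ⟨fun n hn => ?_, ?_⟩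
  · rw [fwdDiff_iterate_shift_sub]
    constructor
    · have := Finset.card_nsmul_le_sum (Finset.range h)
        (fun i => (fwdDiff 1)^[q + 1] g (n + i)) lo
        fun i hi => (h1 (n + i) (by have := Finset.mem_range.1 hi; omega)).1
      simpa using this
    · have := Finset.sum_le_card_nsmul (Finset.range h)
        (fun i => (fwdDiff 1)^[q + 1] g (n + i)) hi
        fun i hi => (h1 (n + i) (by have := Finset.mem_range.1 hi; omega)).2
      simpa using this
  · refine h2.imp (fun h2 n hn => ?_) (fun h2 n hn => ?_)
    · rw [fwdDiff_iterate_shift_sub]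
      exact Finset.sum_nonneg fun i hi => h2 _ (by have := Finset.mem_range.1 hi; omega)
    · rw [fwdDiff_iterate_shift_sub]
      exact Finset.sum_nonpos fun i hi => h2 _ (by have := Finset.mem_range.1 hi; omega)

/-- The Kusmin–Landau inequality. -/
theorem norm_sum_expTwoPiI_le_inv {K : ℕ} {lo hi : ℝ} {g : ℕ → ℝ}
    (hg : DifferenceBounds 1 K lo hi g) (hlo : 0 < lo) (hhi : hi ≤ 1 / 2) :
    ‖∑ n ∈ Finset.range K, expTwoPiI (g n)‖ ≤ 1 / lo := by
  obtain ⟨h1, h2⟩ := hg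
  set δ : ℕ → ℝ := fun n => g (n + 1) - g n with hδ
  have hδ1 : ∀ n < K, lo ≤ δ n ∧ δ n ≤ 1 / 2 := fun n hn =>
    ⟨(h1 n hn).1, (h1 n hn).2.trans hhi⟩
  have hδpos : ∀ n < K, 0 < δ n := fun n hn => hlo.trans_le (hδ1 n hn).1
  -- Since e(g n) = c n (e(g (n+1)) - e(g n)), summation by parts leaves two boundary terms and the
  -- total variation of c.
  set c : ℕ → ℂ := fun n => (expTwoPiI (δ n) - 1)⁻¹ with hc
  have hge : ∀ n < K, 4 * δ n ≤ ‖expTwoPiI (δ n) - 1‖ := fun n hn =>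
    norm_expTwoPiI_sub_one_ge (hδpos n hn).le (hδ1 n hn).2
  have hne : ∀ n < K, expTwoPiI (δ n) - 1 ≠ 0 := fun n hn => by
    rw [← norm_pos_iff]
    linarith [hge n hn, hδpos n hn]
  have hcn : ∀ n < K, ‖c n‖ ≤ 1 / (4 * lo) := fun n hn => by
    rw [hc, norm_inv, ← one_div]
    exact one_div_le_one_div_of_le (by positivity) (by linarith [hge n hn, (hδ1 n hn).1])
  have hstep : ∀ n < K, c n * (expTwoPiI (g (n + 1)) - expTwoPiI (g n)) = expTwoPiI (g n) := by
    intro n hn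
    have e : expTwoPiI (g (n + 1)) = expTwoPiI (δ n) * expTwoPiI (g n) := by
      rw [← expTwoPiI_add, hδ]
      simp
    have := hne n hn
    rw [e, hc]
    field_simp
  -- The two denominators are at least 4δ each and 2π ≤ 8, whence 8/16 = 1/2.
  have hcd : ∀ n, n + 1 < K → ‖c n - c (n + 1)‖ ≤ 1 / 2 * |1 / δ (n + 1) - 1 / δ n| := by
    intro n hn
    have hn' : n < K := by omega
    have p0 := hδpos n hn'
    have p1 := hδpos (n + 1) hn
    rw [hc]
    simp only
    rw [inv_sub_inv (hne n hn') (hne (n + 1) hn), norm_div, norm_mul]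
    have e : expTwoPiI (δ (n + 1)) - 1 - (expTwoPiI (δ n) - 1) =
        expTwoPiI (δ (n + 1)) - expTwoPiI (δ n) := by ring
    have e2 : |1 / δ (n + 1) - 1 / δ n| = |δ (n + 1) - δ n| / (δ n * δ (n + 1)) := by
      rw [one_div, one_div, inv_sub_inv p1.ne' p0.ne', abs_div, abs_sub_comm,
        abs_of_pos (mul_pos p1 p0), mul_comm (δ (n + 1))]
    rw [e, e2, ← mul_div_assoc, div_le_div_iff₀ (by
      have := hne n hn'; have := hne (n + 1) hn; positivity) (by positivity)]
    have h3 := norm_expTwoPiI_sub_le (δ (n + 1)) (δ n)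
    have h4 : 2 * Real.pi * |δ (n + 1) - δ n| ≤ 8 * |δ (n + 1) - δ n| := by
      have := Real.pi_le_four
      gcongr
      linarith
    calc ‖expTwoPiI (δ (n + 1)) - expTwoPiI (δ n)‖ * (δ n * δ (n + 1))
        ≤ 8 * |δ (n + 1) - δ n| * (δ n * δ (n + 1)) := by gcongr; linarith
      _ = 1 / 2 * |δ (n + 1) - δ n| * ((4 * δ n) * (4 * δ (n + 1))) := by ring
      _ ≤ _ := by gcongr; exacts [hge n hn', hge (n + 1) hn]
  -- Monotonicity of δ gives all increments of 1/δ one sign, so their absolute values telescope.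
  obtain ⟨σ, hσ1, hσ⟩ : ∃ σ : ℝ, |σ| = 1 ∧ ∀ n, n + 1 < K →
      |1 / δ (n + 1) - 1 / δ n| = σ * (1 / δ (n + 1) - 1 / δ n) := by
    have hD : ∀ n, (fwdDiff 1)^[1 + 1] g n = δ (n + 1) - δ n := fun n => rfl
    rcases h2 with h2 | h2
    · refine ⟨-1, by simp, fun n hn => ?_⟩
      have h3 : δ n ≤ δ (n + 1) := by
        have := h2 n (by omega)
        rw [hD] at this
        linarith
      rw [abs_of_nonpos (sub_nonpos.2 (one_div_le_one_div_of_le (hδpos n (by omega)) h3))]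
      ring
    · refine ⟨1, by simp, fun n hn => ?_⟩
      have h3 : δ (n + 1) ≤ δ n := by
        have := h2 n (by omega)
        rw [hD] at this
        linarith
      rw [abs_of_nonneg (sub_nonneg.2 (one_div_le_one_div_of_le (hδpos (n + 1) hn) h3))]
      ring
  have main : ∀ m, m + 1 ≤ K → ‖∑ n ∈ Finset.range (m + 1), expTwoPiI (g n)
      - c m * expTwoPiI (g (m + 1))‖ ≤ 1 / (4 * lo) + 1 / 2 * (σ * (1 / δ m - 1 / δ 0)) := by
    intro m
    induction m with
    | zero =>
      intro hm
      have e : ∑ n ∈ Finset.range (0 + 1), expTwoPiI (g n) - c 0 * expTwoPiI (g (0 + 1))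
          = -(c 0 * expTwoPiI (g 0)) := by
        have := hstep 0 (by omega)
        simp only [zero_add, Finset.sum_range_one] at this ⊢
        linear_combination -this
      rw [e, norm_neg, norm_mul, norm_expTwoPiI]
      simpa using hcn 0 (by omega)
    | succ m ih =>
      intro hm
      have e : ∑ n ∈ Finset.range (m + 1 + 1), expTwoPiI (g n)
          - c (m + 1) * expTwoPiI (g (m + 1 + 1)) =
          (∑ n ∈ Finset.range (m + 1), expTwoPiI (g n) - c m * expTwoPiI (g (m + 1))) +
            (c m - c (m + 1)) * expTwoPiI (g (m + 1)) := by
        have := hstep (m + 1) (by omega)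
        rw [Finset.sum_range_succ]
        linear_combination -this
      rw [e]
      refine (norm_add_le _ _).trans ?_
      rw [norm_mul, norm_expTwoPiI, mul_one]
      have h3 := hcd m (by omega)
      rw [hσ m (by omega)] at h3
      have h4 := ih (by omega)
      linarith
  rcases Nat.eq_zero_or_pos K with hK | hK
  · subst hK
    simp
    positivity
  · obtain ⟨m, rfl⟩ : ∃ m, K = m + 1 := ⟨K - 1, by omega⟩
    have h3 := main m le_rfl
    have h4 : ‖c m * expTwoPiI (g (m + 1))‖ ≤ 1 / (4 * lo) := by
      rw [norm_mul, norm_expTwoPiI, mul_one]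
      exact hcn m (by omega)
    have h5 : σ * (1 / δ m - 1 / δ 0) ≤ 1 / lo := by
      refine (le_abs_self _).trans ?_
      rw [abs_mul, hσ1, one_mul]
      have b : ∀ n < m + 1, 0 ≤ 1 / δ n ∧ 1 / δ n ≤ 1 / lo := fun n hn =>
        ⟨by have := hδpos n hn; positivity, one_div_le_one_div_of_le hlo (hδ1 n hn).1⟩
      have b1 := b m (by omega)
      have b2 := b 0 (by omega)
      rw [abs_le]
      constructor <;> linarith
    have h6 := norm_sub_norm_le (∑ n ∈ Finset.range (m + 1), expTwoPiI (g n))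
      (c m * expTwoPiI (g (m + 1)))
    have e : 1 / (4 * lo) = 1 / 4 * (1 / lo) := by field_simp
    rw [e] at h3 h4
    linarith

/-- H times the sum is a sum over K + H windows of length H, with z extended by zero. Cauchy–Schwarz
over the windows leaves correlations of pairs of shifts h, h' < H; for fixed h each value of |h -
h'| occurs at most twice. -/
theorem norm_sq_sum_le_of_correlations {K H : ℕ} (hH : 1 ≤ H) (z : ℕ → ℂ) (B : ℕ → ℝ)
    (hB : ∀ d < H, ‖∑ n ∈ Finset.range (K - d), z (n + d) * starRingEnd ℂ (z n)‖ ≤ B d) :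
    ‖∑ n ∈ Finset.range K, z n‖ ^ 2 ≤ 2 * ((K + H) / H) * ∑ d ∈ Finset.range H, B d := by
  set I : Finset ℤ := Finset.Ico (-(H : ℤ)) K with hI
  set w : ℤ → ℂ := fun m => if 0 ≤ m ∧ m < K then z m.toNat else 0 with hw
  have hB0 : ∀ d < H, 0 ≤ B d := fun d hd => (norm_nonneg _).trans (hB d hd)
  have hcard : (I.card : ℝ) = K + H := by
    rw [hI, Int.card_Ico]
    have : ((K : ℤ) - -(H : ℤ)).toNat = K + H := by omega
    rw [this]
    push_cast
    ring
  have hS : ∀ h < H, ∑ m ∈ I, w (m + h) = ∑ n ∈ Finset.range K, z n := by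
    intro h hh
    symm
    refine Finset.sum_of_injOn (fun n : ℕ => (n : ℤ) - h) ?_ ?_ ?_ ?_
    · intro a _ b _ hab
      simp only at hab
      omega
    · intro n hn
      simp only [Finset.coe_range, Set.mem_Iio] at hn
      simp only [hI, Finset.coe_Ico, Set.mem_Ico]
      omega
    · intro m _ hm
      rw [hw]
      simp only
      rw [if_neg]
      rintro ⟨h1, h2⟩
      refine hm ⟨(m + h).toNat, ?_, ?_⟩
      · simp only [Finset.coe_range, Set.mem_Iio]; omega
      · simp only; omega
    · intro n hn
      rw [Finset.mem_range] at hn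
      rw [hw]
      simp only
      rw [if_pos (by omega)]
      congr 1
      omega
  have hA : ∀ h < H, ∀ h' ≤ h,
      ‖∑ m ∈ I, w (m + h) * starRingEnd ℂ (w (m + h'))‖ ≤ B (h - h') := by
    intro h hh h' hh'
    refine le_of_eq_of_le ?_ (hB (h - h') (by omega))
    congr 1
    symm
    refine Finset.sum_of_injOn (fun n : ℕ => (n : ℤ) - h') ?_ ?_ ?_ ?_
    · intro a _ b _ hab
      simp only at hab
      omega
    · intro n hn
      simp only [Finset.coe_range, Set.mem_Iio] at hn
      simp only [hI, Finset.coe_Ico, Set.mem_Ico]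
      omega
    · intro m _ hm
      rw [hw]
      simp only
      by_cases c1 : 0 ≤ m + h' ∧ m + h' < K
      · by_cases c2 : 0 ≤ m + h ∧ m + h < K
        · refine absurd ⟨(m + h').toNat, ?_, ?_⟩ hm
          · simp only [Finset.coe_range, Set.mem_Iio]; omega
          · simp only; omega
        · rw [if_neg c2, zero_mul]
      · rw [if_neg c1, map_zero, mul_zero]
    · intro n hn
      rw [Finset.mem_range] at hn
      rw [hw]
      simp only
      rw [if_pos (by omega), if_pos (by omega)]
      congr 2
      · omega
      · congr 1; omega
  have hA' : ∀ h < H, ∀ h' < H, ‖∑ m ∈ I, w (m + h) * starRingEnd ℂ (w (m + h'))‖ ≤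
      if h' ≤ h then B (h - h') else B (h' - h) := by
    intro h hh h' hh'
    split_ifs with hc
    · exact hA h hh h' hc
    · refine le_of_eq_of_le ?_ (hA h' hh' h (by omega))
      rw [← Complex.norm_conj, map_sum]
      congr 1
      refine Finset.sum_congr rfl fun m _ => ?_
      rw [map_mul, Complex.conj_conj, mul_comm]
  have hrow : ∀ h < H, ∑ h' ∈ Finset.range H, (if h' ≤ h then B (h - h') else B (h' - h)) ≤
      2 * ∑ d ∈ Finset.range H, B d := by
    intro h hh
    rw [Finset.sum_ite, two_mul]
    refine add_le_add ?_ ?_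
    · have : ∑ x ∈ Finset.range H with x ≤ h, B (h - x) =
          ∑ d ∈ (Finset.filter (fun x => x ≤ h) (Finset.range H)).image (fun x => h - x), B d := by
        rw [Finset.sum_image]
        intro a ha b hb hab
        simp only [Finset.coe_filter, Finset.mem_range, Set.mem_ofPred_eq] at ha hb hab
        omega
      rw [this]
      refine Finset.sum_le_sum_of_subset_of_nonneg ?_ fun d hd _ => hB0 d (Finset.mem_range.1 hd)
      intro d hd
      simp only [Finset.mem_image, Finset.mem_filter, Finset.mem_range] at hd ⊢
      omega
    · have : ∑ x ∈ Finset.range H with ¬x ≤ h, B (x - h) =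
          ∑ d ∈ (Finset.filter (fun x => ¬x ≤ h) (Finset.range H)).image (fun x => x - h), B d := by
        rw [Finset.sum_image]
        intro a ha b hb hab
        simp only [Finset.coe_filter, Finset.mem_range, Set.mem_ofPred_eq] at ha hb hab
        omega
      rw [this]
      refine Finset.sum_le_sum_of_subset_of_nonneg ?_ fun d hd _ => hB0 d (Finset.mem_range.1 hd)
      intro d hd
      simp only [Finset.mem_image, Finset.mem_filter, Finset.mem_range] at hd ⊢
      omega
  have hHS : (H : ℂ) * ∑ n ∈ Finset.range K, z n =
      ∑ m ∈ I, ∑ h ∈ Finset.range H, w (m + h) := by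
    rw [Finset.sum_comm, Finset.sum_congr rfl fun h hh => hS h (Finset.mem_range.1 hh)]
    simp
  have hsq : ∑ m ∈ I, ‖∑ h ∈ Finset.range H, w (m + h)‖ ^ 2 ≤
      H * (2 * ∑ d ∈ Finset.range H, B d) := by
    have e : ((∑ m ∈ I, ‖∑ h ∈ Finset.range H, w (m + h)‖ ^ 2 : ℝ) : ℂ) =
        ∑ h ∈ Finset.range H, ∑ h' ∈ Finset.range H,
          ∑ m ∈ I, w (m + h) * starRingEnd ℂ (w (m + h')) := by
      push_cast
      simp only [← Complex.mul_conj', map_sum, Finset.sum_mul_sum]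
      rw [Finset.sum_comm]
      refine Finset.sum_congr rfl fun h _ => Finset.sum_comm
    have e2 : ∑ m ∈ I, ‖∑ h ∈ Finset.range H, w (m + h)‖ ^ 2 =
        ‖((∑ m ∈ I, ‖∑ h ∈ Finset.range H, w (m + h)‖ ^ 2 : ℝ) : ℂ)‖ := by
      rw [Complex.norm_real, Real.norm_of_nonneg (Finset.sum_nonneg fun _ _ => by positivity)]
    rw [e2, e]
    calc _ ≤ ∑ h ∈ Finset.range H, ∑ h' ∈ Finset.range H,
          ‖∑ m ∈ I, w (m + h) * starRingEnd ℂ (w (m + h'))‖ :=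
          (norm_sum_le _ _).trans (Finset.sum_le_sum fun _ _ => norm_sum_le _ _)
      _ ≤ ∑ h ∈ Finset.range H, 2 * ∑ d ∈ Finset.range H, B d := by
          refine Finset.sum_le_sum fun h hh => ?_
          rw [Finset.mem_range] at hh
          exact (Finset.sum_le_sum fun h' hh' => hA' h hh h' (Finset.mem_range.1 hh')).trans
            (hrow h hh)
      _ = _ := by simp
  have hHpos : (0 : ℝ) < H := by exact_mod_cast hH
  have hfin : (H : ℝ) ^ 2 * ‖∑ n ∈ Finset.range K, z n‖ ^ 2 ≤
      (K + H) * (H * (2 * ∑ d ∈ Finset.range H, B d)) := by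
    calc (H : ℝ) ^ 2 * ‖∑ n ∈ Finset.range K, z n‖ ^ 2
        = ‖∑ m ∈ I, ∑ h ∈ Finset.range H, w (m + h)‖ ^ 2 := by
          rw [← hHS, norm_mul, mul_pow, Complex.norm_natCast]
      _ ≤ (∑ m ∈ I, ‖∑ h ∈ Finset.range H, w (m + h)‖) ^ 2 := by
          gcongr
          exact norm_sum_le _ _
      _ ≤ I.card * ∑ m ∈ I, ‖∑ h ∈ Finset.range H, w (m + h)‖ ^ 2 := sq_sum_le_card_mul_sum_sq
      _ ≤ _ := by rw [hcard]; gcongr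
  rw [← mul_le_mul_iff_right₀ (by positivity : (0 : ℝ) < (H : ℝ) ^ 2)]
  refine hfin.trans_eq ?_
  field_simp

/-- Weyl differencing for a phase function. -/
theorem norm_sq_sum_expTwoPiI_le {K H : ℕ} (hH : 1 ≤ H) (g : ℕ → ℝ) (B : ℕ → ℝ)
    (hB : ∀ d < H, ‖∑ n ∈ Finset.range (K - d), expTwoPiI (g (n + d) - g n)‖ ≤ B d) :
    ‖∑ n ∈ Finset.range K, expTwoPiI (g n)‖ ^ 2 ≤
      2 * ((K + H) / H) * ∑ d ∈ Finset.range H, B d := by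
  refine norm_sq_sum_le_of_correlations hH _ B fun d hd => ?_
  simp only [conj_expTwoPiI, ← expTwoPiI_add, ← sub_eq_add_neg]
  exact hB d hd

theorem norm_sum_expTwoPiI_le_card (K : ℕ) (g : ℕ → ℝ) :
    ‖∑ n ∈ Finset.range K, expTwoPiI (g n)‖ ≤ K := by
  refine (norm_sum_le _ _).trans ?_
  simp [norm_expTwoPiI]

end ExponentialSums

/-! ### Power savings by repeated differencing -/

section PowerSaving

/-- Exponential sums of length at most `2N` whose `(q+1)`-st phase differences are monotone and
lie between `N ^ (-2 + κ)` and `N ^ (-κ)`, within a factor `N ^ (1 / 2)` of each other, have a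
power saving. -/
def HasPowerSaving (q : ℕ) (κ : ℝ) : Prop :=
  ∃ η C : ℝ, 0 < η ∧ 0 < C ∧ ∀ N K : ℕ, 1 ≤ N → K ≤ 2 * N → ∀ (lo hi : ℝ) (g : ℕ → ℝ),
    DifferenceBounds (q + 1) K lo hi g → (N : ℝ) ^ (-2 + κ) ≤ lo → hi ≤ (N : ℝ) ^ (-κ) →
    hi ≤ (N : ℝ) ^ (1 / 2 : ℝ) * lo →
    ‖∑ n ∈ Finset.range K, expTwoPiI (g n)‖ ≤ C * (N : ℝ) ^ (1 - η)

theorem HasPowerSaving.mono {q : ℕ} {κ κ' : ℝ} (h : HasPowerSaving q κ) (hκ : κ ≤ κ') :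
    HasPowerSaving q κ' := by
  obtain ⟨η, C, hη, hC, h⟩ := h
  refine ⟨η, C, hη, hC, fun N K hN hK lo hi g hg h1 h2 h3 => h N K hN hK lo hi g hg ?_ ?_ h3⟩
  · exact (Real.rpow_le_rpow_of_exponent_le (by exact_mod_cast hN) (by linarith)).trans h1
  · exact h2.trans (Real.rpow_le_rpow_of_exponent_le (by exact_mod_cast hN) (by linarith))

theorem sum_range_inv_le (H : ℕ) (hH : 1 ≤ H) :
    ∑ d ∈ Finset.range H, ((d : ℝ))⁻¹ ≤ 1 + Real.log H := by
  refine le_trans ?_ (harmonic_le_one_add_log H)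
  obtain ⟨m, rfl⟩ : ∃ m, H = m + 1 := ⟨H - 1, by omega⟩
  rw [Finset.sum_range_succ', harmonic, Finset.sum_range_succ]
  push_cast
  simp only [inv_zero, add_zero]
  have : (0 : ℝ) ≤ ((m : ℝ) + 1)⁻¹ := by positivity
  linarith

theorem le_mul_rpow_of_sq_le {x C X η : ℝ} (hx : 0 ≤ x) (hC : 1 ≤ C) (hX : 0 < X)
    (h : x ^ 2 ≤ C * X ^ (2 - 2 * η)) : x ≤ C * X ^ (1 - η) := by
  rw [← pow_le_pow_iff_left₀ hx (by positivity) two_ne_zero, mul_pow, ← Real.rpow_natCast (X ^ _),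
    ← Real.rpow_mul hX.le]
  refine h.trans ?_
  have e : (1 - η) * ((2 : ℕ) : ℝ) = 2 - 2 * η := by push_cast; ring
  rw [e]
  have : C ≤ C ^ 2 := by nlinarith
  gcongr

/-- After one differencing step Kusmin–Landau applies to each shift d with d·hi ≤ 1/2, which
dictates H = min(N, ⌊1/(2hi)⌋). The cross term N·hi/lo ≤ N^(3/2) is admissible because κ ≤ 1/2. -/
theorem hasPowerSaving_one {κ : ℝ} (h0 : 0 < κ) (h1 : κ ≤ 1 / 2) : HasPowerSaving 1 κ := by
  refine ⟨κ / 4, 90 * (1 + 2 / κ), by positivity, by positivity, ?_⟩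
  intro N K hN hK lo hi g hg hlo hhi hr
  have hN1 : (1 : ℝ) ≤ N := by exact_mod_cast hN
  have hN0 : (0 : ℝ) < N := by linarith
  have hC1 : 1 ≤ 90 * (1 + 2 / κ) := by
    have : 0 < 2 / κ := by positivity
    linarith
  have hKR : (K : ℝ) ≤ 2 * N := by exact_mod_cast hK
  have hlo0 : 0 < lo := (Real.rpow_pos_of_pos hN0 _).trans_le hlo
  rcases Nat.eq_zero_or_pos K with hK0 | hK0
  · subst hK0
    simp only [Finset.range_zero, Finset.sum_empty, norm_zero]
    positivity
  have hlohi : lo ≤ hi := (hg.1 0 hK0).1.trans (hg.1 0 hK0).2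
  have hhi0 : 0 < hi := hlo0.trans_le hlohi
  -- If hi > 1/2 then N^κ ≤ 2, and the trivial bound suffices.
  rcases lt_or_ge (1 / 2) hi with hbig | hsmall
  · have h2 : (N : ℝ) ^ κ ≤ 2 := by
      have h3 : 1 / 2 ≤ (N : ℝ) ^ (-κ) := by linarith
      rw [Real.rpow_neg hN0.le, ← one_div] at h3
      rw [le_div_iff₀ (Real.rpow_pos_of_pos hN0 _)] at h3
      linarith
    have e : (N : ℝ) = (N : ℝ) ^ (κ / 4) * (N : ℝ) ^ (1 - κ / 4) := by
      rw [← Real.rpow_add hN0]; simp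
    have h4 : (N : ℝ) ^ (κ / 4) ≤ 2 :=
      (Real.rpow_le_rpow_of_exponent_le hN1 (by linarith)).trans h2
    calc ‖∑ n ∈ Finset.range K, expTwoPiI (g n)‖ ≤ K := norm_sum_expTwoPiI_le_card K g
      _ ≤ 2 * N := hKR
      _ = 2 * (N : ℝ) ^ (κ / 4) * (N : ℝ) ^ (1 - κ / 4) := by rw [mul_assoc, ← e]
      _ ≤ _ := by
        have : 0 < 2 / κ := by positivity
        exact mul_le_mul_of_nonneg_right (by linarith) (by positivity)
  set Q : ℕ := ⌊1 / (2 * hi)⌋₊ with hQ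
  have hx1 : 1 ≤ 1 / (2 * hi) := by rw [le_div_iff₀ (by positivity)]; linarith
  have hQ1 : 1 ≤ Q := Nat.le_floor (by simpa using hx1)
  have hQle : (Q : ℝ) ≤ 1 / (2 * hi) := Nat.floor_le (by positivity)
  have hQge : 1 / (4 * hi) ≤ Q := by
    have h2 := Nat.lt_floor_add_one (1 / (2 * hi))
    have h3 : (1 : ℝ) ≤ Q := by exact_mod_cast hQ1
    have e : 1 / (2 * hi) = 2 * (1 / (4 * hi)) := by field_simp; ring
    rw [← hQ] at h2
    linarith
  set H : ℕ := min N Q with hH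
  have hH1 : 1 ≤ H := le_min hN hQ1
  have hHR : (0 : ℝ) < H := by exact_mod_cast hH1
  have hHN : (H : ℝ) ≤ N := by exact_mod_cast min_le_left N Q
  have hHQ : (H : ℝ) ≤ Q := by exact_mod_cast min_le_right N Q
  have hinv : 1 / (H : ℝ) ≤ 1 / N + 4 * hi := by
    rcases min_choice N Q with h | h
    · rw [hH, h]
      linarith
    · rw [hH, h]
      have h2 := one_div_le_one_div_of_le (by positivity) hQge
      rw [one_div_one_div] at h2
      have : 0 < 1 / (N : ℝ) := by positivity
      linarith
  -- The shift d = 0 gets the trivial bound K; there the convention 0⁻¹ = 0 switches off the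
  -- Kusmin–Landau term.
  have hS := norm_sq_sum_expTwoPiI_le hH1 g
    (fun d => (if d = 0 then (K : ℝ) else 0) + (1 / lo) * (d : ℝ)⁻¹) (K := K) (fun d hd => by
      rcases Nat.eq_zero_or_pos d with hd0 | hd0
      · subst hd0
        simpa using norm_sum_expTwoPiI_le_card K fun n => g (n + 0) - g n
      · have hd' : (0 : ℝ) < d := by exact_mod_cast hd0
        have e : 1 / lo * (d : ℝ)⁻¹ = 1 / (d * lo) := by field_simp
        rw [if_neg hd0.ne', zero_add, e]
        refine norm_sum_expTwoPiI_le_inv (hg.shift_sub d) (by positivity) ?_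
        have h2 : (d : ℝ) ≤ 1 / (2 * hi) :=
          le_trans (by exact_mod_cast hd.le) (hHQ.trans hQle)
        rw [le_div_iff₀ (by positivity)] at h2
        linarith)
  rw [Finset.sum_add_distrib, ← Finset.mul_sum, Finset.sum_ite_eq' (Finset.range H) 0,
    if_pos (Finset.mem_range.2 hH1)] at hS
  set l := 1 + Real.log N with hl
  have hl1 : 1 ≤ l := by have := Real.log_nonneg hN1; linarith
  have hharm : ∑ d ∈ Finset.range H, ((d : ℝ))⁻¹ ≤ l := by
    refine (sum_range_inv_le H hH1).trans ?_
    have := Real.log_le_log hHR hHN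
    linarith
  have hlk : l ≤ (1 + 2 / κ) * (N : ℝ) ^ (κ / 2) := by
    have h2 := Real.log_le_rpow_div hN0.le (half_pos h0)
    have h3 : (1 : ℝ) ≤ (N : ℝ) ^ (κ / 2) := Real.one_le_rpow hN1 (by positivity)
    have e : (N : ℝ) ^ (κ / 2) / (κ / 2) = 2 / κ * (N : ℝ) ^ (κ / 2) := by field_simp
    rw [e] at h2
    linarith
  have hA : 2 * (((K : ℝ) + H) / H) ≤ 6 * N * (1 / N + 4 * hi) := by
    calc 2 * (((K : ℝ) + H) / H) = 2 * (K + H) * (1 / H) := by ring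
      _ ≤ 6 * N * (1 / H) := mul_le_mul_of_nonneg_right (by linarith) (by positivity)
      _ ≤ _ := by gcongr
  have hP : (N : ℝ) ≤ (N : ℝ) ^ (2 - κ) := by
    nth_rewrite 1 [← Real.rpow_one (N : ℝ)]
    exact Real.rpow_le_rpow_of_exponent_le hN1 (by linarith)
  have hP2 : (N : ℝ) ^ 2 * hi ≤ (N : ℝ) ^ (2 - κ) := by
    calc (N : ℝ) ^ 2 * hi ≤ (N : ℝ) ^ 2 * (N : ℝ) ^ (-κ) := by gcongr
      _ = _ := by rw [← Real.rpow_natCast, ← Real.rpow_add hN0]; norm_num; congr 1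
  have hP3 : 1 / lo ≤ (N : ℝ) ^ (2 - κ) := by
    have h2 := one_div_le_one_div_of_le (Real.rpow_pos_of_pos hN0 _) hlo
    rw [one_div ((N : ℝ) ^ _), ← Real.rpow_neg hN0.le] at h2
    refine h2.trans_eq ?_
    congr 1; ring
  have hP4 : N * (hi / lo) ≤ (N : ℝ) ^ (2 - κ) := by
    have h2 : hi / lo ≤ (N : ℝ) ^ (1 / 2 : ℝ) := by rwa [div_le_iff₀ hlo0]
    calc N * (hi / lo) ≤ (N : ℝ) ^ (1 : ℝ) * (N : ℝ) ^ (1 / 2 : ℝ) := by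
          rw [Real.rpow_one]; gcongr
      _ = (N : ℝ) ^ (1 + 1 / 2 : ℝ) := by rw [← Real.rpow_add hN0]
      _ ≤ _ := Real.rpow_le_rpow_of_exponent_le hN1 (by linarith)
  set X := (N : ℝ) ^ (2 - κ) with hX
  have hX0 : 0 < X := Real.rpow_pos_of_pos hN0 _
  have hfin : ‖∑ n ∈ Finset.range K, expTwoPiI (g n)‖ ^ 2 ≤ 90 * l * X := by
    calc _ ≤ 6 * N * (1 / N + 4 * hi) * (2 * N + 1 / lo * l) := by
          refine hS.trans ?_
          gcongr
      _ = 12 * N + 48 * (N ^ 2 * hi) + l * (6 * (1 / lo) + 24 * (N * (hi / lo))) := by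
          field_simp; ring
      _ ≤ 12 * X + 48 * X + l * (6 * X + 24 * X) := by gcongr
      _ ≤ _ := by nlinarith
  refine le_mul_rpow_of_sq_le (norm_nonneg _) hC1 hN0 (hfin.trans ?_)
  have e : (N : ℝ) ^ (2 - 2 * (κ / 4)) = (N : ℝ) ^ (κ / 2) * X := by
    rw [hX, ← Real.rpow_add hN0]; congr 1; ring
  rw [e]
  calc 90 * l * X ≤ 90 * ((1 + 2 / κ) * (N : ℝ) ^ (κ / 2)) * X := by gcongr
    _ = _ := by ring

/-- Shifts d < H = ⌈N^(κ/2)⌉ keep the differences below N^(-κ/2), so correlations save N^η while the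
diagonal saves N^(κ/2). The square root gives the exponent min(κ/4, η/2). -/
theorem HasPowerSaving.succ {q : ℕ} {κ : ℝ} (h0 : 0 < κ) (h1 : κ ≤ 1)
    (h : HasPowerSaving q (κ / 2)) : HasPowerSaving (q + 1) κ := by
  obtain ⟨η, C, hη, hC, h⟩ := h
  refine ⟨min (κ / 4) (η / 2), 12 + 6 * C, lt_min (by positivity) (by positivity),
    by positivity, ?_⟩
  intro N K hN hK lo hi g hg hlo hhi hr
  have hN1 : (1 : ℝ) ≤ N := by exact_mod_cast hN
  have hN0 : (0 : ℝ) < N := by linarith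
  have hKR : (K : ℝ) ≤ 2 * N := by exact_mod_cast hK
  have hlo0 : 0 < lo := (Real.rpow_pos_of_pos hN0 _).trans_le hlo
  set T := (N : ℝ) ^ (κ / 2) with hT
  have hT1 : 1 ≤ T := Real.one_le_rpow hN1 (by positivity)
  set H : ℕ := ⌈T⌉₊ with hH
  have hH1 : 1 ≤ H := Nat.one_le_ceil_iff.2 (by linarith)
  have hHR : (0 : ℝ) < H := by exact_mod_cast hH1
  have hTH : T ≤ H := Nat.le_ceil T
  have hHN : (H : ℝ) ≤ N := by
    have : T ≤ N := by
      rw [hT]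
      nth_rewrite 2 [← Real.rpow_one (N : ℝ)]
      exact Real.rpow_le_rpow_of_exponent_le hN1 (by linarith)
    exact_mod_cast Nat.ceil_le.2 this
  set Y := C * (N : ℝ) ^ (1 - η) with hY
  have hY0 : 0 < Y := by positivity
  have hS := norm_sq_sum_expTwoPiI_le hH1 g
    (fun d => (if d = 0 then (K : ℝ) else 0) + Y) (K := K) (fun d hd => by
      rcases Nat.eq_zero_or_pos d with hd0 | hd0
      · subst hd0
        have := norm_sum_expTwoPiI_le_card K fun n => g (n + 0) - g n
        simp only [Nat.sub_zero, if_true]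
        linarith
      · have hd1 : (1 : ℝ) ≤ d := by exact_mod_cast hd0
        have hdT : (d : ℝ) ≤ T := (Nat.lt_ceil.1 hd).le
        rw [if_neg hd0.ne', zero_add]
        refine h N (K - d) hN (by omega) _ _ _ (hg.shift_sub d) ?_ ?_ ?_
        · calc (N : ℝ) ^ (-2 + κ / 2) ≤ (N : ℝ) ^ (-2 + κ) :=
                Real.rpow_le_rpow_of_exponent_le hN1 (by linarith)
            _ ≤ lo := hlo
            _ ≤ d * lo := le_mul_of_one_le_left hlo0.le hd1
        · calc d * hi ≤ d * (N : ℝ) ^ (-κ) := by gcongr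
            _ ≤ T * (N : ℝ) ^ (-κ) := by gcongr
            _ = _ := by rw [hT, ← Real.rpow_add hN0]; congr 1; ring
        · calc d * hi ≤ d * ((N : ℝ) ^ (1 / 2 : ℝ) * lo) := by gcongr
            _ = _ := by ring)
  rw [Finset.sum_add_distrib, Finset.sum_ite_eq' (Finset.range H) 0,
    if_pos (Finset.mem_range.2 hH1), Finset.sum_const, Finset.card_range, nsmul_eq_mul] at hS
  set η' := min (κ / 4) (η / 2) with hη'
  have hP1 : (N : ℝ) ^ 2 / T ≤ (N : ℝ) ^ (2 - 2 * η') := by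
    rw [hT, ← Real.rpow_natCast, ← Real.rpow_sub hN0]
    refine Real.rpow_le_rpow_of_exponent_le hN1 ?_
    have : η' ≤ κ / 4 := min_le_left _ _
    push_cast
    linarith
  have hP2 : N * (N : ℝ) ^ (1 - η) ≤ (N : ℝ) ^ (2 - 2 * η') := by
    nth_rewrite 1 [← Real.rpow_one (N : ℝ)]
    rw [← Real.rpow_add hN0]
    refine Real.rpow_le_rpow_of_exponent_le hN1 ?_
    have : η' ≤ η / 2 := min_le_right _ _
    linarith
  refine le_mul_rpow_of_sq_le (norm_nonneg _) (by linarith) hN0 ?_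
  calc _ ≤ 2 * ((2 * N + N) / H) * (2 * N + H * Y) := by
        refine hS.trans ?_
        gcongr
    _ = 12 * (N ^ 2 / H) + 6 * (N * Y) := by field_simp; ring
    _ ≤ 12 * (N ^ 2 / T) + 6 * (N * Y) := by gcongr
    _ = 12 * (N ^ 2 / T) + 6 * C * (N * (N : ℝ) ^ (1 - η)) := by rw [hY]; ring
    _ ≤ 12 * (N : ℝ) ^ (2 - 2 * η') + 6 * C * (N : ℝ) ^ (2 - 2 * η') := by gcongr
    _ = _ := by ring

theorem hasPowerSaving {q : ℕ} (hq : 1 ≤ q) {κ : ℝ} (hκ : 0 < κ) : HasPowerSaving q κ := by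
  induction q, hq using Nat.le_induction generalizing κ with
  | base =>
    exact (hasPowerSaving_one (lt_min hκ (by norm_num)) (min_le_right κ _)).mono
      (min_le_left _ _)
  | succ q hq ih =>
    exact ((ih (half_pos (lt_min hκ one_pos))).succ (lt_min hκ one_pos) (min_le_right κ 1)).mono
      (min_le_left _ _)

end PowerSaving

/-! ### From derivatives of the leading term to differences of the phase -/

section PhaseDifferences

/-- Induction passes to the family of unit increments of the G j and uses the mean value theorem
once per step. -/
theorem exists_fwdDiff_iterate_eq (m : ℕ) (G : ℕ → ℝ → ℝ) (a : ℝ)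
    (hG : ∀ j < m, ∀ x, a ≤ x → HasDerivAt (G j) (G (j + 1) x) x) (x₀ : ℝ) (n : ℕ)
    (hx : a ≤ x₀ + n) :
    ∃ ξ, x₀ + n ≤ ξ ∧ ξ ≤ x₀ + n + m ∧
      (fwdDiff 1)^[m] (fun n : ℕ => G 0 (x₀ + n)) n = G m ξ := by
  induction m generalizing G with
  | zero => exact ⟨x₀ + n, le_rfl, by simp, rfl⟩
  | succ m ih =>
    obtain ⟨ξ, h1, h2, h3⟩ := ih (fun j x => G j (x + 1) - G j x) (fun j hj x hx =>
      ((hG j (by omega) (x + 1) (by linarith)).comp_add_const x 1).sub (hG j (by omega) x hx))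
    have e : fwdDiff 1 (fun n : ℕ => G 0 (x₀ + n)) =
        fun n : ℕ => G 0 (x₀ + n + 1) - G 0 (x₀ + n) := by
      funext n
      simp only [fwdDiff]
      push_cast
      rw [add_assoc]
    have hder := fun x hx => hG m (Nat.lt_succ_self m) x hx
    obtain ⟨ζ, ⟨hζ1, hζ2⟩, hζ⟩ := exists_hasDerivAt_eq_slope (G m) (G (m + 1))
      (lt_add_one ξ)
      (fun x hx' => (hder x (by linarith [hx'.1])).continuousAt.continuousWithinAt)
      (fun x hx' => hder x (by linarith [hx'.1]))
    refine ⟨ζ, by linarith, by push_cast; linarith, ?_⟩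
    rw [Function.iterate_succ_apply, e, h3, hζ]
    simp

variable {H : Subring (Germ (atTop : Filter ℝ) ℝ)} {k : ℕ} {f : Fin k → ℝ → ℝ}

/-- Coefficients of size at most `(log log M)^2`, supported on `i` and on indices `l` for which
`f l` is dominated by `f i`. -/
structure DominatedCoefficients (f : Fin k → ℝ → ℝ) (i : Fin k) (M : ℝ) (c : Fin k → ℝ) :
    Prop where
  abs_le : ∀ l, |c l| ≤ Real.log (Real.log M) ^ 2
  one_le : 1 ≤ c i
  dominated : ∀ l, l ≠ i → c l = 0 ∨
    GrowthLT (fun t => Real.log (Real.log t) ^ 4) (fun t => f i t / f l t)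

theorem tendsto_log_log : Tendsto (fun t => Real.log (Real.log t)) atTop atTop :=
  Real.tendsto_log_atTop.comp Real.tendsto_log_atTop

theorem eventually_log_log_mono :
    ∀ᶠ M in atTop, ∀ t, M ≤ t → 0 ≤ Real.log (Real.log M) ∧
      Real.log (Real.log M) ≤ Real.log (Real.log t) := by
  filter_upwards [tendsto_log_log.eventually_ge_atTop 0, eventually_gt_atTop 1] with M h0 h1 t ht
  have := Real.log_pos h1
  exact ⟨h0, Real.log_le_log this (Real.log_le_log (by linarith) ht)⟩

/-- Coefficients are at most log_2^2 while the derivative ratios exceed log_2^3, so once log_2 t ≥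
2k every other term is at most 1/(2k) of the leading derivative. -/
theorem eventually_abs_sum_sub_le (hH : IsHardyField H) (hf : ∀ l, GermMem H (f l))
    (hB : ∀ l, StrictlyBetweenPowers (f l)) (i : Fin k) (m : ℕ) :
    ∀ᶠ M in atTop, ∀ t, M ≤ t → ∀ c : Fin k → ℝ, DominatedCoefficients f i M c →
      |∑ l, iteratedDeriv m (f l) t * c l - iteratedDeriv m (f i) t * c i| ≤
        1 / 2 * |iteratedDeriv m (f i) t| := by
  have hk : (0 : ℝ) < k := by exact_mod_cast i.pos
  have h1 : ∀ l, ∀ᶠ t in atTop,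
      GrowthLT (fun t => Real.log (Real.log t) ^ 4) (fun t => f i t / f l t) →
      2 * k * Real.log (Real.log t) ^ 2 * |iteratedDeriv m (f l) t| ≤
        |iteratedDeriv m (f i) t| := by
    intro l
    by_cases hg : GrowthLT (fun t => Real.log (Real.log t) ^ 4) (fun t => f i t / f l t)
    · filter_upwards [eventually_rpow_le_iteratedDeriv_div hH (hf i) (hf l) (hB i) (hB l) hg m
        (a := 3) (by norm_num) (by norm_num), tendsto_log_log.eventually_ge_atTop (2 * k),
        (iteratedDeriv_ne_zero_and_abs_log_le hH (hf l) (hB l) m).1] with t h2 h3 h4 _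
      have h5 : 0 < |iteratedDeriv m (f l) t| := abs_pos.2 h4
      rw [abs_div, le_div_iff₀ h5] at h2
      refine le_trans ?_ h2
      have e : Real.log (Real.log t) ^ (3 : ℝ) = Real.log (Real.log t) ^ 3 := by norm_cast
      rw [e]
      refine mul_le_mul_of_nonneg_right ?_ h5.le
      calc 2 * k * Real.log (Real.log t) ^ 2
          ≤ Real.log (Real.log t) * Real.log (Real.log t) ^ 2 := by gcongr
        _ = _ := by ring
    · exact Eventually.of_forall fun t h => absurd h hg
  obtain ⟨a, ha⟩ := eventually_atTop.1 (eventually_all.2 h1)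
  filter_upwards [eventually_log_log_mono, eventually_ge_atTop a] with M hM hMa t ht c hc
  have hll := hM t ht
  have e : ∑ l, iteratedDeriv m (f l) t * c l - iteratedDeriv m (f i) t * c i =
      ∑ l ∈ Finset.univ.erase i, iteratedDeriv m (f l) t * c l := by
    rw [← Finset.sum_erase_add _ _ (Finset.mem_univ i)]
    ring
  rw [e]
  refine (Finset.abs_sum_le_sum_abs _ _).trans ?_
  calc ∑ l ∈ Finset.univ.erase i, |iteratedDeriv m (f l) t * c l|
      ≤ ∑ l ∈ Finset.univ.erase i, |iteratedDeriv m (f i) t| / (2 * k) := by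
        refine Finset.sum_le_sum fun l hl => ?_
        rcases hc.dominated l (Finset.ne_of_mem_erase hl) with h0 | hg
        · rw [h0, mul_zero, abs_zero]
          positivity
        · have h2 := ha t (hMa.trans ht) l hg
          have h3 : |c l| ≤ Real.log (Real.log t) ^ 2 :=
            (hc.abs_le l).trans (pow_le_pow_left₀ hll.1 hll.2 2)
          rw [abs_mul, le_div_iff₀ (by positivity)]
          refine le_trans ?_ h2
          calc |iteratedDeriv m (f l) t| * |c l| * (2 * k)
              ≤ |iteratedDeriv m (f l) t| * Real.log (Real.log t) ^ 2 * (2 * k) := by gcongr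
            _ = _ := by ring
    _ ≤ ∑ l : Fin k, |iteratedDeriv m (f i) t| / (2 * k) :=
        Finset.sum_le_sum_of_subset_of_nonneg (Finset.erase_subset _ _)
          fun _ _ _ => by positivity
    _ = _ := by
        rw [Finset.sum_const, Finset.card_univ, Fintype.card_fin, nsmul_eq_mul]
        field_simp

/-- The sign is that of f_i^(m), hence independent of M and of the coefficients; c i ≥ 1 absorbs the
error of one half. -/
theorem exists_sign_and_eventually_sum_bounds (hH : IsHardyField H)
    (hf : ∀ l, GermMem H (f l)) (hB : ∀ l, StrictlyBetweenPowers (f l)) (i : Fin k) (m : ℕ) :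
    ∃ σ : ℝ, (σ = 1 ∨ σ = -1) ∧ ∀ᶠ M in atTop, ∀ t, M ≤ t → ∀ c : Fin k → ℝ,
      DominatedCoefficients f i M c →
      1 / 2 * |iteratedDeriv m (f i) t| ≤ σ * ∑ l, iteratedDeriv m (f l) t * c l ∧
      σ * ∑ l, iteratedDeriv m (f l) t * c l ≤
        2 * Real.log (Real.log M) ^ 2 * |iteratedDeriv m (f i) t| := by
  have hne := (iteratedDeriv_ne_zero_and_abs_log_le hH (hf i) (hB i) m).1
  have hsign : ∃ σ : ℝ, (σ = 1 ∨ σ = -1) ∧ ∀ᶠ t in atTop,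
      |iteratedDeriv m (f i) t| = σ * iteratedDeriv m (f i) t := by
    rcases ((hf i).iteratedDeriv hH m).eventuallySigned hH with h | h | h
    · exact ⟨1, Or.inl rfl, h.mono fun t ht => by rw [abs_of_pos ht, one_mul]⟩
    · exact ⟨1, Or.inl rfl, h.mono fun t ht => by rw [ht]; simp⟩
    · exact ⟨-1, Or.inr rfl, h.mono fun t ht => by rw [abs_of_neg ht]; ring⟩
  obtain ⟨σ, hσ, hs⟩ := hsign
  obtain ⟨a, ha⟩ := eventually_atTop.1 hs
  refine ⟨σ, hσ, ?_⟩
  filter_upwards [eventually_abs_sum_sub_le hH hf hB i m, eventually_ge_atTop a]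
    with M hM hMa t ht c hc
  have h1 := hM t ht c hc
  have h2 := ha t (hMa.trans ht)
  set S := ∑ l, iteratedDeriv m (f l) t * c l
  set D := iteratedDeriv m (f i) t
  have h3 : |σ * S - |D| * c i| ≤ 1 / 2 * |D| := by
    have e : σ * S - |D| * c i = σ * (S - D * c i) := by rw [h2]; ring
    have hσ1 : |σ| = 1 := by rcases hσ with rfl | rfl <;> simp
    rwa [e, abs_mul, hσ1, one_mul]
  have h4 := abs_le.1 h3
  have h5 := hc.one_le
  have h6 := (le_abs_self _).trans (hc.abs_le i)
  have h7 := abs_nonneg D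
  constructor
  · nlinarith [h4.1]
  · nlinarith [h4.2]

/-- Bounds for the leading term give bounds for the differences of the phase. -/
theorem exists_sign_and_eventually_differenceBounds (hH : IsHardyField H)
    (hf : ∀ l, GermMem H (f l)) (hB : ∀ l, StrictlyBetweenPowers (f l)) (i : Fin k) (m : ℕ) :
    ∃ σ : ℝ, (σ = 1 ∨ σ = -1) ∧ ∀ᶠ M : ℕ in atTop, ∀ r s : ℝ, 1 ≤ r → 1 ≤ s →
      ∀ c : Fin k → ℝ, DominatedCoefficients f i M c → ∀ lo hi : ℝ,
      (∀ x : ℝ, M ≤ x → x ≤ 4 * M →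
        lo ≤ s ^ m / r * (1 / 2 * |iteratedDeriv m (f i) (s * x)|) ∧
        s ^ m / r * (2 * Real.log (Real.log M) ^ 2 * |iteratedDeriv m (f i) (s * x)|) ≤ hi) →
      DifferenceBounds m (M + 1) lo hi
        (fun n => σ * (1 / r * ∑ l, f l (s * ((M + n : ℕ) : ℝ)) * c l)) := by
  obtain ⟨σ, hσ, hb⟩ := exists_sign_and_eventually_sum_bounds hH hf hB i m
  -- The constant sign one order higher supplies the monotonicity of the m-th differences.
  obtain ⟨σ', hσ', hb'⟩ := exists_sign_and_eventually_sum_bounds hH hf hB i (m + 1)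
  refine ⟨σ, hσ, ?_⟩
  have hder : ∀ᶠ t in atTop, ∀ j ∈ Finset.range (m + 1), ∀ l,
      HasDerivAt (iteratedDeriv j (f l)) (iteratedDeriv (j + 1) (f l) t) t := by
    rw [eventually_all_finset]
    intro j _
    rw [eventually_all]
    intro l
    have := ((hf l).iteratedDeriv hH j).hasDerivAt hH
    rwa [← iteratedDeriv_succ] at this
  obtain ⟨a, ha⟩ := eventually_atTop.1 hder
  filter_upwards [tendsto_natCast_atTop_atTop.eventually hb,
    tendsto_natCast_atTop_atTop.eventually hb',
    tendsto_natCast_atTop_atTop.eventually (eventually_ge_atTop a),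
    eventually_ge_atTop (m + 1)] with M h1 h1' h2 h3 r s hr hs c hc lo hi hlohi
  have hsM : ∀ x : ℝ, (M : ℝ) ≤ x → (M : ℝ) ≤ s * x := by
    intro x hx
    have h0 : (0 : ℝ) ≤ M := by positivity
    nlinarith
  have hs0 : 0 < s := by linarith
  have hr0 : 0 < r := by linarith
  set G : ℕ → ℝ → ℝ := fun j x =>
    s ^ j / r * (σ * ∑ l, iteratedDeriv j (f l) (s * x) * c l) with hG
  have hGd : ∀ j < m + 1, ∀ x, (M : ℝ) ≤ x → HasDerivAt (G j) (G (j + 1) x) x := by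
    intro j hj x hx
    have hl : ∀ l, HasDerivAt (fun x => iteratedDeriv j (f l) (s * x) * c l)
        (iteratedDeriv (j + 1) (f l) (s * x) * s * c l) x := by
      intro l
      have h4 := ha (s * x) (h2.trans (hsM x hx)) j (Finset.mem_range.2 hj) l
      have h5 : HasDerivAt (fun x => s * x) s x := by simpa using (hasDerivAt_id x).const_mul s
      exact (h4.comp x h5).mul_const _
    have h6 := ((HasDerivAt.fun_sum fun l (_ : l ∈ Finset.univ) => hl l).const_mul σ).const_mul
      (s ^ j / r)
    refine h6.congr_deriv ?_
    have e : ∑ l, iteratedDeriv (j + 1) (f l) (s * x) * s * c l =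
        s * ∑ l, iteratedDeriv (j + 1) (f l) (s * x) * c l := by
      rw [Finset.mul_sum]
      exact Finset.sum_congr rfl fun l _ => by ring
    rw [e, hG]
    ring
  have hg : (fun n : ℕ => σ * (1 / r * ∑ l, f l (s * ((M + n : ℕ) : ℝ)) * c l)) =
      fun n : ℕ => G 0 (M + n) := by
    funext n
    simp only [hG, iteratedDeriv_zero, pow_zero]
    push_cast
    ring
  -- Intermediate points reach at most M + M + (m+1) ≤ 3M.
  have hM4 : ∀ n < M + 1, ∀ ξ : ℝ, (M : ℝ) + n ≤ ξ → ξ ≤ M + n + ((m + 1 : ℕ) : ℝ) →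
      (M : ℝ) ≤ ξ ∧ ξ ≤ 4 * M := by
    intro n hn ξ hξ1 hξ2
    have h4 : (n : ℝ) ≤ M := by exact_mod_cast Nat.lt_succ_iff.1 hn
    have h5 : (((m + 1 : ℕ) : ℝ)) ≤ M := by exact_mod_cast h3
    have h6 : (0 : ℝ) ≤ n := by positivity
    constructor <;> linarith
  have hsr : ∀ j : ℕ, 0 < s ^ j / r := fun j => by positivity
  have hσσ : σ * σ' = 1 ∨ σ * σ' = -1 := by
    rcases hσ with rfl | rfl <;> rcases hσ' with rfl | rfl <;> simp
  have hσ2 : σ' * σ' = 1 := by rcases hσ' with rfl | rfl <;> simp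
  have hnext : ∀ n < M + 1, ∃ y : ℝ, 0 ≤ y ∧
      (fwdDiff 1)^[m + 1] (fun n : ℕ => G 0 (M + n)) n = σ * σ' * y := by
    intro n hn
    obtain ⟨ξ, hξ1, hξ2, hξ⟩ := exists_fwdDiff_iterate_eq (m + 1) G M hGd M n (by simp)
    obtain ⟨h5, h6⟩ := hM4 n hn ξ hξ1 hξ2
    have h7 := (h1' (s * ξ) (hsM ξ h5) c hc).1
    refine ⟨s ^ (m + 1) / r * (σ' * ∑ l, iteratedDeriv (m + 1) (f l) (s * ξ) * c l), ?_, ?_⟩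
    · exact mul_nonneg (hsr _).le (le_trans (by positivity) h7)
    · rw [hξ, hG]
      linear_combination (-(s ^ (m + 1) / r *
        (σ * ∑ l, iteratedDeriv (m + 1) (f l) (s * ξ) * c l))) * hσ2
  rw [hg]
  refine ⟨fun n hn => ?_, ?_⟩
  · obtain ⟨ξ, hξ1, hξ2, hξ⟩ := exists_fwdDiff_iterate_eq m G M
      (fun j hj => hGd j (by omega)) M n (by simp)
    obtain ⟨h5, h6⟩ := hM4 n hn ξ hξ1 (by push_cast; linarith)
    obtain ⟨h7, h8⟩ := h1 (s * ξ) (hsM ξ h5) c hc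
    obtain ⟨h9, h10⟩ := hlohi ξ h5 h6
    rw [hξ]
    exact ⟨h9.trans (mul_le_mul_of_nonneg_left h7 (hsr m).le),
      (mul_le_mul_of_nonneg_left h8 (hsr m).le).trans h10⟩
  · refine hσσ.imp (fun h n hn => ?_) (fun h n hn => ?_)
    · obtain ⟨y, hy, e⟩ := hnext n hn
      rw [e, h]; linarith
    · obtain ⟨y, hy, e⟩ := hnext n hn
      rw [e, h]; linarith

end PhaseDifferences

/-! ### The ranges of f_i(sM)/r -/

section LongSums

variable {H : Subring (Germ (atTop : Filter ℝ) ℝ)} {k : ℕ} {f : Fin k → ℝ → ℝ}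

theorem eventually_mul_log_pow_le (A : ℝ) (n : ℕ) {ε : ℝ} (hε : 0 < ε) :
    ∀ᶠ M : ℕ in atTop, A * Real.log M ^ n ≤ (M : ℝ) ^ ε := by
  have h := (isLittleO_log_rpow_rpow_atTop (n : ℝ) hε).bound
    (by positivity : 0 < (|A| + 1)⁻¹)
  filter_upwards [tendsto_natCast_atTop_atTop.eventually h, eventually_ge_atTop 1] with M h1 h2
  have h3 : 0 ≤ Real.log M := Real.log_nonneg (by exact_mod_cast h2)
  have h4 : (0 : ℝ) ≤ (M : ℝ) ^ ε := by positivity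
  rw [Real.rpow_natCast, Real.norm_of_nonneg (by positivity), Real.norm_of_nonneg h4,
    inv_mul_eq_div, le_div_iff₀ (by positivity)] at h1
  have h5 : A ≤ |A| + 1 := (le_abs_self A).trans (by linarith)
  have h6 : 0 ≤ Real.log M ^ n := by positivity
  nlinarith

theorem eventually_mul_le_pow_four :
    ∀ᶠ M : ℕ in atTop, ∀ s x : ℝ, 1 ≤ s → s ≤ M * Real.log M ^ 2 → M ≤ x → x ≤ 4 * M →
      s * x ≤ (M : ℝ) ^ 4 := by
  filter_upwards [eventually_mul_log_pow_le 4 2 (ε := 1) one_pos, eventually_ge_atTop 1]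
    with M h1 h2 s x hs1 hs2 hx1 hx2
  rw [Real.rpow_one] at h1
  have hM : (1 : ℝ) ≤ M := by exact_mod_cast h2
  have hx0 : 0 ≤ x := by linarith
  calc s * x ≤ (M * Real.log M ^ 2) * (4 * M) := by gcongr
    _ = M ^ 2 * (4 * Real.log M ^ 2) := by ring
    _ ≤ M ^ 2 * M := by gcongr
    _ = (M : ℝ) ^ 3 := by ring
    _ ≤ (M : ℝ) ^ 4 := pow_le_pow_right₀ hM (by norm_num)

/-- The size of the `m`-th derivative of the leading term, up to `M ^ (1 / 8)`. -/
theorem eventually_leading_term_bounds (hH : IsHardyField H) {f : ℝ → ℝ} (hf : GermMem H f)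
    (hB : StrictlyBetweenPowers f)
    (hlog : GrowthLT (fun t => Real.log (Real.log t)) (fun t => Real.log (f t))) (m : ℕ) :
    ∀ᶠ M : ℕ in atTop, ∀ r s : ℝ, 1 ≤ r → 1 ≤ s → s ≤ M * Real.log M ^ 2 →
      ∀ x : ℝ, M ≤ x → x ≤ 4 * M →
        (M : ℝ) ^ (-(1 / 8) : ℝ) * (f (s * M) / r / M ^ m) ≤
          s ^ m / r * (1 / 2 * |iteratedDeriv m f (s * x)|) ∧
        s ^ m / r * (2 * Real.log (Real.log M) ^ 2 * |iteratedDeriv m f (s * x)|) ≤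
          (M : ℝ) ^ (1 / 8 : ℝ) * (f (s * M) / r / M ^ m) := by
  obtain ⟨C, hC, h1⟩ := exists_abs_iteratedDeriv_le hH hf hB m
  obtain ⟨C', hC', h2⟩ := exists_doubling hH hf hB
  -- As sx ≤ M^4, a loss of (sx)^(1/64) is at most M^(1/16). The remaining M^(1/16) absorbs 2·4^m,
  -- which comes from the factor 1/2 and from x ≤ 4M.
  obtain ⟨a, ha⟩ := eventually_atTop.1 (h1.and
    ((eventually_le_abs_iteratedDeriv hH hf hB m (ε := 1 / 64) (by norm_num)).and
      (h2.and ((eventually_forall_ge_le hH hf hB hlog).and (hB.eventually_ge 1)))))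
  filter_upwards [tendsto_natCast_atTop_atTop.eventually (eventually_ge_atTop a),
    eventually_ge_atTop 3, eventually_mul_le_pow_four,
    eventually_mul_log_pow_le (2 * (C * C')) 2 (ε := 1 / 8) (by norm_num),
    eventually_mul_log_pow_le (2 * 4 ^ m) 0 (ε := 1 / 16) (by norm_num)]
    with M hMa hM3 hM4 hMl hMm r s hr hs hsM x hx1 hx2
  have hM1 : (1 : ℝ) ≤ M := by exact_mod_cast (by omega : 1 ≤ M)
  have hM0 : (0 : ℝ) < M := by linarith
  have hs0 : 0 < s := by linarith
  have hr0 : 0 < r := by linarith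
  have hx0 : 0 < x := by linarith
  have hy : (M : ℝ) ≤ s * M := le_mul_of_one_le_left hM0.le hs
  have hyt : s * M ≤ s * x := by gcongr
  have hty : s * x ≤ 4 * (s * M) := by nlinarith
  have ht0 : 0 < s * x := by positivity
  obtain ⟨-, -, hdb, hmono, hfy⟩ := ha (s * M) (hMa.trans hy)
  obtain ⟨hup, hlow, -⟩ := ha (s * x) (hMa.trans (hy.trans hyt))
  have hfy0 : 0 < f (s * M) := by linarith
  have hfm := hmono _ hyt
  have hfx0 : 0 < f (s * x) := by linarith
  have hfd := hdb _ hyt hty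
  have ht4 := hM4 s x hs hsM hx1 hx2
  set D := |iteratedDeriv m f (s * x)| with hD
  have e : ∀ z : ℝ, s ^ m / r * (z * D) = z * (D * (s * x) ^ m) / r / x ^ m := by
    intro z
    rw [mul_pow]
    field_simp
  rw [e, e]
  constructor
  · have h3 : (M : ℝ) ^ (-(1 / 16) : ℝ) ≤ (s * x) ^ (-(1 / 64) : ℝ) := by
      have h4 := Real.rpow_le_rpow_of_nonpos ht0 ht4 (by norm_num : (-(1 / 64) : ℝ) ≤ 0)
      refine le_trans (le_of_eq ?_) h4
      rw [← Real.rpow_natCast, ← Real.rpow_mul hM0.le]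
      norm_num
    have h5 : (M : ℝ) ^ (-(1 / 8) : ℝ) * 4 ^ m ≤ 1 / 2 * (s * x) ^ (-(1 / 64) : ℝ) := by
      have e8 : (M : ℝ) ^ (-(1 / 8) : ℝ) * (M : ℝ) ^ (1 / 16 : ℝ) = (M : ℝ) ^ (-(1 / 16) : ℝ) := by
        rw [← Real.rpow_add hM0]; norm_num
      rw [pow_zero, mul_one] at hMm
      have h6 : 0 ≤ (M : ℝ) ^ (-(1 / 8) : ℝ) := by positivity
      nlinarith
    calc (M : ℝ) ^ (-(1 / 8) : ℝ) * (f (s * M) / r / M ^ m)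
        = ((M : ℝ) ^ (-(1 / 8) : ℝ) * 4 ^ m) * f (s * M) / r / (4 * M) ^ m := by
          rw [mul_pow]; field_simp
      _ ≤ (1 / 2 * (s * x) ^ (-(1 / 64) : ℝ)) * f (s * x) / r / x ^ m := by gcongr
      _ = 1 / 2 * (f (s * x) * (s * x) ^ (-(1 / 64) : ℝ)) / r / x ^ m := by ring
      _ ≤ _ := by gcongr
  · have hll : Real.log (Real.log M) ^ 2 ≤ Real.log M ^ 2 := by
      have h3 : 1 ≤ Real.log M := by
        rw [Real.le_log_iff_exp_le hM0]
        have : (3 : ℝ) ≤ M := by exact_mod_cast hM3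
        linarith [Real.exp_one_lt_d9]
      exact pow_le_pow_left₀ (Real.log_nonneg h3) (Real.log_le_self (by linarith)) 2
    have h4 : D * (s * x) ^ m ≤ C * (C' * f (s * M)) := hup.trans (by gcongr)
    calc 2 * Real.log (Real.log M) ^ 2 * (D * (s * x) ^ m) / r / x ^ m
        ≤ 2 * Real.log M ^ 2 * (C * (C' * f (s * M))) / r / M ^ m := by
          gcongr
      _ = (2 * (C * C') * Real.log M ^ 2) * (f (s * M) / r / M ^ m) := by ring
      _ ≤ _ := by gcongr

/-- Conjugation negates the phase without changing the norm, so the relevant difference may be taken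
positive. -/
theorem norm_sum_Icc_expTwoPiI (M : ℕ) {σ : ℝ} (hσ : σ = 1 ∨ σ = -1) (φ : ℕ → ℝ) :
    ‖∑ n ∈ Finset.Icc M (2 * M), expTwoPiI (φ n)‖ =
      ‖∑ n ∈ Finset.range (M + 1), expTwoPiI (σ * φ (M + n))‖ := by
  have e : ∑ n ∈ Finset.Icc M (2 * M), expTwoPiI (φ n) =
      ∑ n ∈ Finset.range (M + 1), expTwoPiI (φ (M + n)) := by
    rw [show Finset.Icc M (2 * M) = Finset.Ico M (2 * M + 1) from rfl,
      Finset.sum_Ico_eq_sum_range]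
    congr 2
    omega
  rw [e]
  rcases hσ with rfl | rfl
  · simp
  · rw [← Complex.norm_conj, map_sum]
    simp only [conj_expTwoPiI, neg_mul, one_mul]

/-- The range in which the Kusmin–Landau inequality applies directly. -/
theorem eventually_norm_sum_le_of_small (hH : IsHardyField H) (hf : ∀ l, GermMem H (f l))
    (hB : ∀ l, StrictlyBetweenPowers (f l))
    (hlog : ∀ l, GrowthLT (fun t => Real.log (Real.log t)) (fun t => Real.log (f l t)))
    (i : Fin k) :
    ∀ᶠ M : ℕ in atTop, ∀ r s : ℝ, 1 ≤ r → 1 ≤ s → s ≤ M * Real.log M ^ 2 →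
      ∀ c : Fin k → ℝ, DominatedCoefficients f i M c →
      Real.log M ^ 4 ≤ f i (s * M) / r → f i (s * M) / r ≤ (M : ℝ) ^ (1 / 2 : ℝ) →
      ‖∑ n ∈ Finset.Icc M (2 * M), expTwoPiI (1 / r * ∑ l, f l (s * n) * c l)‖ ≤
        32 * M / Real.log M ^ 2 := by
  obtain ⟨σ, hσ, hd⟩ := exists_sign_and_eventually_differenceBounds hH hf hB i 1
  obtain ⟨a, ha⟩ := eventually_atTop.1 ((eventually_le_deriv_mul hH (hf i) (hB i) (hlog i)).and
    ((eventually_forall_ge_le hH (hf i) (hB i) (hlog i)).and ((hB i).eventually_ge 1)))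
  filter_upwards [hd, eventually_leading_term_bounds hH (hf i) (hB i) (hlog i) 1,
    tendsto_natCast_atTop_atTop.eventually (eventually_ge_atTop a), eventually_ge_atTop 3,
    eventually_mul_le_pow_four, eventually_mul_log_pow_le 2 0 (ε := 3 / 8) (by norm_num)]
    with M hd hlt hMa hM3 hM4 hM2 r s hr hs hsM c hc hG1 hG2
  have hM1 : (1 : ℝ) ≤ M := by exact_mod_cast (by omega : 1 ≤ M)
  have hM0 : (0 : ℝ) < M := by linarith
  have hs0 : 0 < s := by linarith
  have hr0 : 0 < r := by linarith
  have hl1 : 1 ≤ Real.log M := by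
    rw [Real.le_log_iff_exp_le hM0]
    have : (3 : ℝ) ≤ M := by exact_mod_cast hM3
    linarith [Real.exp_one_lt_d9]
  have hl0 : 0 < Real.log M := by linarith
  set G := f i (s * M) / r with hG
  rw [norm_sum_Icc_expTwoPiI M hσ fun n => 1 / r * ∑ l, f l (s * n) * c l]
  -- Here 32 = 2·4·4 collects the factor 1/2, x ≤ 4M and log(sx) ≤ 4 log M; one of the four
  -- logarithms in G ≥ log^4 M is spent.
  have hDB := hd r s hr hs c hc (Real.log M ^ 3 / (32 * M))
    ((M : ℝ) ^ (1 / 8 : ℝ) * (G / M ^ 1)) fun x hx1 hx2 => by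
      refine ⟨?_, (hlt r s hr hs hsM x hx1 hx2).2⟩
      have hx0 : 0 < x := by linarith
      have hy : (M : ℝ) ≤ s * M := le_mul_of_one_le_left hM0.le hs
      have hyt : s * M ≤ s * x := by gcongr
      have ht0 : 0 < s * x := by positivity
      have h1t : 1 < s * x := by
        have : (3 : ℝ) ≤ M := by exact_mod_cast hM3
        linarith
      obtain ⟨hder, -, hft⟩ := ha (s * x) (hMa.trans (hy.trans hyt))
      have hfm := (ha (s * M) (hMa.trans hy)).2.1 _ hyt
      have hlt0 : 0 < Real.log (s * x) := Real.log_pos h1t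
      have hlogt : Real.log (s * x) ≤ 4 * Real.log M := by
        have := Real.log_le_log ht0 (hM4 s x hs hsM hx1 hx2)
        rwa [Real.log_pow] at this
      rw [← div_le_iff₀ (by positivity)] at hder
      rw [iteratedDeriv_one, pow_one]
      calc Real.log M ^ 3 / (32 * M) = Real.log M ^ 4 / (32 * (M * Real.log M)) := by
            field_simp
        _ ≤ G / (32 * (M * Real.log M)) := by gcongr
        _ = 1 / 2 * (f i (s * M) / ((4 * M) * (4 * Real.log M))) / r := by
            rw [hG]; field_simp; ring
        _ ≤ 1 / 2 * (f i (s * x) / (x * Real.log (s * x))) / r := by gcongr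
        _ = s / r * (1 / 2 * (f i (s * x) / (s * x * Real.log (s * x)))) := by field_simp
        _ ≤ _ := by
            gcongr
            exact hder.trans (le_abs_self _)
  have hhi : (M : ℝ) ^ (1 / 8 : ℝ) * (G / M ^ 1) ≤ 1 / 2 := by
    rw [pow_zero, mul_one] at hM2
    rw [pow_one, ← mul_div_assoc, div_le_iff₀ hM0]
    have e : (M : ℝ) = (M : ℝ) ^ (1 / 8 : ℝ) * (M : ℝ) ^ (1 / 2 : ℝ) * (M : ℝ) ^ (3 / 8 : ℝ) := by
      rw [← Real.rpow_add hM0, ← Real.rpow_add hM0]; norm_num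
    calc (M : ℝ) ^ (1 / 8 : ℝ) * G ≤ (M : ℝ) ^ (1 / 8 : ℝ) * (M : ℝ) ^ (1 / 2 : ℝ) := by gcongr
      _ = 1 / 2 * ((M : ℝ) ^ (1 / 8 : ℝ) * (M : ℝ) ^ (1 / 2 : ℝ) * 2) := by ring
      _ ≤ 1 / 2 * ((M : ℝ) ^ (1 / 8 : ℝ) * (M : ℝ) ^ (1 / 2 : ℝ) * (M : ℝ) ^ (3 / 8 : ℝ)) := by
          gcongr
      _ = 1 / 2 * M := by rw [← e]
  refine (norm_sum_expTwoPiI_le_inv hDB (by positivity) hhi).trans ?_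
  rw [one_div_div]
  gcongr
  norm_num

/-- The range in which `q` differencing steps give a power saving. -/
theorem eventually_norm_sum_le_of_between (hH : IsHardyField H) (hf : ∀ l, GermMem H (f l))
    (hB : ∀ l, StrictlyBetweenPowers (f l))
    (hlog : ∀ l, GrowthLT (fun t => Real.log (Real.log t)) (fun t => Real.log (f l t)))
    (i : Fin k) {q : ℕ} (hq : 1 ≤ q) :
    ∀ᶠ M : ℕ in atTop, ∀ r s : ℝ, 1 ≤ r → 1 ≤ s → s ≤ M * Real.log M ^ 2 →
      ∀ c : Fin k → ℝ, DominatedCoefficients f i M c →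
      (M : ℝ) ^ (q - 1 / 2 : ℝ) ≤ f i (s * M) / r → f i (s * M) / r ≤ (M : ℝ) ^ (q + 1 / 2 : ℝ) →
      ‖∑ n ∈ Finset.Icc M (2 * M), expTwoPiI (1 / r * ∑ l, f l (s * n) * c l)‖ ≤
        32 * M / Real.log M ^ 2 := by
  obtain ⟨σ, hσ, hd⟩ := exists_sign_and_eventually_differenceBounds hH hf hB i (q + 1)
  obtain ⟨η, C, hη, hC, hps⟩ := hasPowerSaving hq (κ := 1 / 8) (by norm_num)
  filter_upwards [hd, eventually_leading_term_bounds hH (hf i) (hB i) (hlog i) (q + 1),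
    eventually_ge_atTop 3, eventually_mul_log_pow_le C 2 hη]
    with M hd hlt hM3 hMl r s hr hs hsM c hc hG1 hG2
  have hM1 : (1 : ℝ) ≤ M := by exact_mod_cast (by omega : 1 ≤ M)
  have hM0 : (0 : ℝ) < M := by linarith
  have hl0 : 0 < Real.log M := Real.log_pos (by exact_mod_cast (by omega : 1 < M))
  set G := f i (s * M) / r with hG
  rw [norm_sum_Icc_expTwoPiI M hσ fun n => 1 / r * ∑ l, f l (s * n) * c l]
  have hDB := hd r s hr hs c hc _ _ fun x hx1 hx2 => hlt r s hr hs hsM x hx1 hx2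
  have hdiv : ∀ a b : ℝ, (M : ℝ) ^ a * ((M : ℝ) ^ b / (M : ℝ) ^ (q + 1)) =
      (M : ℝ) ^ (a + b - (q + 1)) := by
    intro a b
    rw [Real.rpow_sub hM0, Real.rpow_add hM0, mul_div_assoc]
    congr 2
    norm_cast
  -- The bounds satisfy lo ≥ M^(-13/8), hi ≤ M^(-3/8) and hi = M^(1/4) lo, within the requirements
  -- for κ = 1/8.
  have hsum := hps M (M + 1) (by omega) (by omega) _ _ _ hDB ?_ ?_ ?_
  · refine hsum.trans ?_
    rw [le_div_iff₀ (by positivity)]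
    calc C * (M : ℝ) ^ (1 - η) * Real.log M ^ 2 = C * Real.log M ^ 2 * (M : ℝ) ^ (1 - η) := by ring
      _ ≤ (M : ℝ) ^ η * (M : ℝ) ^ (1 - η) := by gcongr
      _ = M := by rw [← Real.rpow_add hM0]; simp
      _ ≤ 32 * M := by linarith
  · calc (M : ℝ) ^ (-2 + 1 / 8 : ℝ)
        ≤ (M : ℝ) ^ (-(1 / 8) + (q - 1 / 2) - (q + 1) : ℝ) :=
          Real.rpow_le_rpow_of_exponent_le hM1 (by linarith)
      _ = (M : ℝ) ^ (-(1 / 8) : ℝ) * ((M : ℝ) ^ (q - 1 / 2 : ℝ) / (M : ℝ) ^ (q + 1)) :=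
          (hdiv _ _).symm
      _ ≤ _ := by gcongr
  · calc (M : ℝ) ^ (1 / 8 : ℝ) * (G / M ^ (q + 1))
        ≤ (M : ℝ) ^ (1 / 8 : ℝ) * ((M : ℝ) ^ (q + 1 / 2 : ℝ) / (M : ℝ) ^ (q + 1)) := by gcongr
      _ = (M : ℝ) ^ (1 / 8 + (q + 1 / 2) - (q + 1) : ℝ) := hdiv _ _
      _ ≤ _ := Real.rpow_le_rpow_of_exponent_le hM1 (by linarith)
  · have hG0 : 0 ≤ G := le_trans (by positivity) hG1
    rw [← mul_assoc, ← Real.rpow_add hM0]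
    refine mul_le_mul_of_nonneg_right ?_ (by positivity)
    exact Real.rpow_le_rpow_of_exponent_le hM1 (by norm_num)

/-- The exponential sum bound when the leading index is fixed. -/
theorem eventually_norm_sum_le (hH : IsHardyField H) (hf : ∀ l, GermMem H (f l))
    (hB : ∀ l, StrictlyBetweenPowers (f l))
    (hlog : ∀ l, GrowthLT (fun t => Real.log (Real.log t)) (fun t => Real.log (f l t)))
    (i : Fin k) :
    ∀ᶠ M : ℕ in atTop, ∀ r s : ℝ, 1 ≤ r → r ≤ |f i M| / Real.log M ^ 4 → 1 ≤ s →
      s ≤ M * Real.log M ^ 2 → ∀ c : Fin k → ℝ, DominatedCoefficients f i M c →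
      ‖∑ n ∈ Finset.Icc M (2 * M), expTwoPiI (1 / r * ∑ l, f l (s * n) * c l)‖ ≤
        32 * M / Real.log M ^ 2 := by
  obtain ⟨j, hj, hA⟩ := (hB i).eventually_bounds
  obtain ⟨a, ha⟩ := eventually_atTop.1 ((hA 1).and
    (eventually_forall_ge_le hH (hf i) (hB i) (hlog i)))
  -- One threshold for M must serve all q; q ≤ 4j is enough because f_i ≤ t^j and sM ≤ M^4.
  have hq : ∀ᶠ M : ℕ in atTop, ∀ q ∈ Finset.Icc 1 (4 * j), ∀ r s : ℝ, 1 ≤ r → 1 ≤ s →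
      s ≤ M * Real.log M ^ 2 → ∀ c : Fin k → ℝ, DominatedCoefficients f i M c →
      (M : ℝ) ^ (q - 1 / 2 : ℝ) ≤ f i (s * M) / r → f i (s * M) / r ≤ (M : ℝ) ^ (q + 1 / 2 : ℝ) →
      ‖∑ n ∈ Finset.Icc M (2 * M), expTwoPiI (1 / r * ∑ l, f l (s * n) * c l)‖ ≤
        32 * M / Real.log M ^ 2 := by
    rw [eventually_all_finset]
    intro q hq
    exact eventually_norm_sum_le_of_between hH hf hB hlog i (Finset.mem_Icc.1 hq).1
  filter_upwards [hq, eventually_norm_sum_le_of_small hH hf hB hlog i,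
    tendsto_natCast_atTop_atTop.eventually (eventually_ge_atTop a), eventually_ge_atTop 3,
    eventually_mul_le_pow_four] with M hq hsmall hMa hM3 hM4 r s hr hrf hs hsM c hc
  have hM1 : (1 : ℝ) ≤ M := by exact_mod_cast (by omega : 1 ≤ M)
  have hM0 : (0 : ℝ) < M := by linarith
  have hl0 : 0 < Real.log M := Real.log_pos (by exact_mod_cast (by omega : 1 < M))
  have hr0 : 0 < r := by linarith
  have hy : (M : ℝ) ≤ s * M := le_mul_of_one_le_left hM0.le hs
  obtain ⟨⟨hfM, -⟩, hmono⟩ := ha M hMa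
  obtain ⟨⟨hfy, -, hfj⟩, -⟩ := ha (s * M) (hMa.trans hy)
  have hG1 : Real.log M ^ 4 ≤ f i (s * M) / r := by
    rw [abs_of_pos hfM, le_div_iff₀ (by positivity)] at hrf
    rw [le_div_iff₀ hr0]
    linarith [hmono _ hy]
  have hG2 : f i (s * M) / r ≤ (M : ℝ) ^ ((4 * j : ℕ) + 1 / 2 : ℝ) := by
    calc f i (s * M) / r ≤ f i (s * M) := div_le_self hfy.le hr
      _ ≤ (s * M) ^ j := by linarith
      _ ≤ ((M : ℝ) ^ 4) ^ j := by
          gcongr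
          exact hM4 s M hs hsM le_rfl (by linarith)
      _ = (M : ℝ) ^ ((4 * j : ℕ) : ℝ) := by rw [Real.rpow_natCast, pow_mul]
      _ ≤ _ := Real.rpow_le_rpow_of_exponent_le hM1 (by linarith)
  classical
  -- For the least such q, minimality gives the lower bound M^(q-1/2); q = 0 is the Kusmin–Landau
  -- range.
  have hex : ∃ q : ℕ, f i (s * M) / r ≤ (M : ℝ) ^ (q + 1 / 2 : ℝ) := ⟨4 * j, hG2⟩
  have hspec := Nat.find_spec hex
  have hle : Nat.find hex ≤ 4 * j := Nat.find_min' hex hG2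
  rcases Nat.eq_zero_or_pos (Nat.find hex) with h0 | h0
  · rw [h0] at hspec
    exact hsmall r s hr hs hsM c hc hG1 (by simpa using hspec)
  · have hmin := Nat.find_min hex (Nat.sub_lt h0 one_pos)
    push Not at hmin
    refine hq _ (Finset.mem_Icc.2 ⟨h0, hle⟩) r s hr hs hsM c hc ?_ hspec
    refine le_trans (le_of_eq ?_) hmin.le
    congr 1
    rw [Nat.cast_pred h0]
    ring

end LongSums

/-! ### The dominating index and the conclusion -/

theorem GrowthLT.log_log_pow_trans {u v w : ℝ → ℝ} (hv : ∀ᶠ t in atTop, v t ≠ 0)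
    (huv : GrowthLT (fun t => Real.log (Real.log t) ^ 4) (fun t => u t / v t))
    (hvw : GrowthLT (fun t => Real.log (Real.log t) ^ 4) (fun t => v t / w t)) :
    GrowthLT (fun t => Real.log (Real.log t) ^ 4) (fun t => u t / w t) := by
  refine tendsto_atTop_mono' _ ?_ hvw
  filter_upwards [hv, huv.eventually_ge_atTop 1, hvw.eventually_ge_atTop 0,
    tendsto_log_log.eventually_ge_atTop 1] with t h0 h1 h2 h3
  have h4 : 1 ≤ Real.log (Real.log t) ^ 4 := one_le_pow₀ h3
  have h5 : 1 ≤ u t / v t := by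
    rw [le_div_iff₀ (by linarith)] at h1
    linarith
  have e : u t / w t / Real.log (Real.log t) ^ 4 =
      u t / v t * (v t / w t / Real.log (Real.log t) ^ 4) := by
    field_simp
  rw [e]
  exact le_mul_of_one_le_left h2 h5

/-- Among the indices with a nonzero coefficient, one dominates all others. -/
theorem exists_dominating_index {k : ℕ} {f : Fin k → ℝ → ℝ}
    (hB : ∀ i, StrictlyBetweenPowers (f i))
    (hratio : ∃ σ : Equiv.Perm (Fin k), ∀ (i : ℕ) (hi : i + 1 < k),
      GrowthLT (fun t => Real.log (Real.log t) ^ 4)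
        (fun t => f (σ ⟨i + 1, hi⟩) t / f (σ ⟨i, Nat.lt_of_succ_lt hi⟩) t))
    {τ : Fin k → ℤ} (hτ : τ ≠ 0) :
    ∃ i, τ i ≠ 0 ∧ ∀ l, l ≠ i → τ l = 0 ∨
      GrowthLT (fun t => Real.log (Real.log t) ^ 4) (fun t => f i t / f l t) := by
  obtain ⟨σ, hσ⟩ := hratio
  have chain : ∀ (a d : ℕ) (h : a + d + 1 < k),
      GrowthLT (fun t => Real.log (Real.log t) ^ 4)
        (fun t => f (σ ⟨a + d + 1, h⟩) t / f (σ ⟨a, by omega⟩) t) := by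
    intro a d
    induction d with
    | zero => exact fun h => hσ a h
    | succ d ih =>
      intro h
      refine GrowthLT.log_log_pow_trans ?_ (hσ (a + d + 1) h) (ih (by omega))
      exact ((hB _).eventually_ge 1).mono fun t ht => by linarith
  set S := Finset.univ.filter fun a : Fin k => τ (σ a) ≠ 0 with hS
  have hne : S.Nonempty := by
    obtain ⟨l, hl⟩ := Function.ne_iff.1 hτ
    exact ⟨σ.symm l, by simpa [hS] using hl⟩
  refine ⟨σ (S.max' hne), (Finset.mem_filter.1 (S.max'_mem hne)).2, fun l hl => ?_⟩
  by_cases h0 : τ l = 0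
  · exact Or.inl h0
  · refine Or.inr ?_
    obtain ⟨b, rfl⟩ := σ.surjective l
    have hb : b ∈ S := Finset.mem_filter.2 ⟨Finset.mem_univ b, h0⟩
    have hlt : b < S.max' hne :=
      lt_of_le_of_ne (S.le_max' b hb) fun h => hl (by rw [← h])
    have hval : (b : ℕ) < (S.max' hne : ℕ) := hlt
    have e : S.max' hne = ⟨b + ((S.max' hne : ℕ) - b - 1) + 1, by
        have := (S.max' hne).isLt
        omega⟩ := Fin.ext (by simp only; omega)
    have hc := chain b ((S.max' hne : ℕ) - b - 1) (by have := (S.max' hne).isLt; omega)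
    rwa [← e] at hc

theorem mainTheorem9
    (H : Subring (Germ (atTop : Filter ℝ) ℝ)) (hH : IsHardyField H)
    (k : ℕ) (hk : 1 ≤ k) (f : Fin k → ℝ → ℝ)
    (hfH : ∀ i, (f i : Germ (atTop : Filter ℝ) ℝ) ∈ H)
    (hB : ∀ i, StrictlyBetweenPowers (f i))
    (hlog : ∀ i, GrowthLT (fun t => Real.log (Real.log t)) (fun t => Real.log (f i t)))
    (hratio : ∃ σ : Equiv.Perm (Fin k), ∀ (i : ℕ) (hi : i + 1 < k),
      GrowthLT (fun t => Real.log (Real.log t) ^ 4)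
        (fun t => f (σ ⟨i + 1, hi⟩) t / f (σ ⟨i, Nat.lt_of_succ_lt hi⟩) t)) :
    ∃ C : ℝ, 0 < C ∧ ∀ M : ℕ, 1 ≤ M → ∀ r s : ℝ,
      r ∈ Set.Icc 1 (min (M * Real.log M ^ 2) (minAbs f M / Real.log M ^ 4)) →
      s ∈ Set.Icc 1 (min (M * Real.log M ^ 2) (minAbs f M / Real.log M ^ 4)) →
      s ≤ r →
      ∀ τ : Fin k → ℤ, τ ≠ 0 →
        (∀ i, (τ i : ℝ) ∈ Set.Icc (-(Real.log (Real.log M) ^ 2)) (Real.log (Real.log M) ^ 2)) →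
        ‖∑ n ∈ Finset.Icc M (2 * M), expTwoPiI (1 / r * ∑ i, f i (s * n) * τ i)‖
          ≤ C * M / Real.log M ^ 2 := by
  obtain ⟨M₀, hM₀⟩ := eventually_atTop.1
    (eventually_all.2 fun i => eventually_norm_sum_le hH hfH hB hlog i)
  -- The summand 2 log² M₀ covers M < M₀ through the trivial bound M + 1 ≤ 2M.
  refine ⟨32 + 2 * Real.log M₀ ^ 2, by positivity, fun M hM r s hr hs _ τ hτ hτb => ?_⟩
  have hM1 : (1 : ℝ) ≤ M := by exact_mod_cast hM
  have hl : 0 < Real.log M := by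
    -- If log M = 0, the upper endpoint M log² M is 0 and the interval for r is empty.
    refine lt_of_le_of_ne (Real.log_nonneg hM1) fun h => ?_
    have := hr.1.trans (hr.2.trans (min_le_left _ _))
    rw [← h] at this
    norm_num at this
  rcases lt_or_ge M M₀ with hlt | hge
  · have h1 : ‖∑ n ∈ Finset.Icc M (2 * M), expTwoPiI (1 / r * ∑ i, f i (s * n) * τ i)‖ ≤
        M + 1 := by
      rw [norm_sum_Icc_expTwoPiI M (Or.inl rfl) fun n => 1 / r * ∑ i, f i (s * n) * τ i]
      exact_mod_cast norm_sum_expTwoPiI_le_card (M + 1) _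
    have h2 : Real.log M ≤ Real.log M₀ :=
      Real.log_le_log (by linarith) (by exact_mod_cast hlt.le)
    refine h1.trans ?_
    rw [le_div_iff₀ (by positivity)]
    calc ((M : ℝ) + 1) * Real.log M ^ 2 ≤ (2 * M) * Real.log M₀ ^ 2 := by gcongr; linarith
      _ ≤ (32 + 2 * Real.log M₀ ^ 2) * M := by linarith
  obtain ⟨i, hi, hdom⟩ := exists_dominating_index hB hratio hτ
  have hrf : r ≤ |f i M| / Real.log M ^ 4 := by
    refine hr.2.trans ((min_le_right _ _).trans ?_)
    gcongr
    exact ciInf_le (Set.finite_range _).bddBelow i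
  have hsM : s ≤ M * Real.log M ^ 2 := hs.2.trans (min_le_left _ _)
  have hmain := hM₀ M hge i r s hr.1 hrf hs.1 hsM
  have hC : 32 * (M : ℝ) / Real.log M ^ 2 ≤
      (32 + 2 * Real.log M₀ ^ 2) * M / Real.log M ^ 2 := by
    gcongr
    have : 0 ≤ Real.log M₀ ^ 2 := by positivity
    linarith
  refine le_trans ?_ hC
  -- A negative leading coefficient is handled by replacing τ with -τ, which conjugates the sum.
  rcases lt_or_gt_of_ne hi with hneg | hpos
  · have h1 := hmain (fun l => -(τ l : ℝ))
      { abs_le := fun l => by rw [abs_neg]; exact abs_le.2 (hτb l)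
        one_le := by exact_mod_cast (by omega : 1 ≤ -τ i)
        dominated := fun l hl' => (hdom l hl').imp (fun h => by simp [h]) id }
    rw [norm_sum_Icc_expTwoPiI M (Or.inr rfl)] at h1
    rw [norm_sum_Icc_expTwoPiI M (Or.inl rfl) fun n => 1 / r * ∑ i, f i (s * n) * τ i]
    simpa using h1
  · exact hmain (fun l => (τ l : ℝ))
      { abs_le := fun l => abs_le.2 (hτb l)
        one_le := by exact_mod_cast (by omega : 1 ≤ τ i)
        dominated := fun l hl' => (hdom l hl').imp (fun h => by simp [h]) id }
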